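/- Let $\mathbb{F}$ be a field of characteristic $0$ and $K$ a finite group. For a finite group $G$ let $\mathbb{F}B(G)=\mathbb{F}\otimes_{\mathbb Z}B(G)$, where $B(G)$ is the Grothendieck group of finite $G$-sets, and let $\mathbb{F}B_K$ be the shifted Burnside functor: $\mathbb{F}B_K(G)=\mathbb{F}B(G\times K)$, a finite $(H,G)$-biset $U$ acting as the $(H\times K,G\times K)$-biset $U\times K$, with products $\mathbb{F}B_K(G)\times\mathbb{F}B_K(H)\to\mathbb{F}B_K(G\times H)$ sending $([X],[Y])$ to the class of $X\times Y$ with action $(g,h,k)(x,y)=((g,k)x,(h,k)y)$. An ideal $I$ of $\mathbb{F}B_K$ is a family of subspaces $I(G)\subseteq\mathbb{F}B_K(G)$, one for each finite group $G$, stable under all finite bisets and under products $\mathbb{F}B_K(G)\times I(H)\to I(G\times H)$. For a subgroup $X$ of a finite group $\Gamma$, put $$e_X^{\Gamma}=\frac{1}{|N_{\Gamma}(X)|}\sum_{Y\leq X}|Y|\,\mu(Y,X)\,[\Gamma/Y]\in\mathbb{F}B(\Gamma),$$ where $\mu$ is the Möbius function of the poset of subgroups of $\Gamma$. A group over $K$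 is a pair $(L,\varphi)$ of a finite group $L$ and a homomorphism $\varphi:L\to K$. A morphism $(L,\varphi)\to(L',\varphi')$ is a group homomorphism $f:L\to L'$ with $i\circ\varphi=\varphi'\circ f$ for some inner automorphism $i$ of $K$; write $(L,\varphi)\twoheadrightarrow(L',\varphi')$ if there is a surjective one. For $X\leq G\times K$ let $p_2:X\to K$ be the restriction of the second projection. For $N\trianglelefteq L$ let $m_{L,N}=\frac1{|L|}\sum_{X\leq L,\,XN=L}|X|\,\mu(X,L)$; the pair $(L,\varphi)$ is a $B_K$-group if $m_{L,N}=0$ for every non-trivial normal subgroup $N$ of $L$ contained in $\ker\varphi$. Let $\mathsf{e}_{L,\varphi}$ be the ideal of $\mathbb{F}B_K$ generated by $e_{L_\varphi}^{L\times K}\in\mathbb{F}B_K(L)$, where $L_\varphi=\{(l,\varphi(l))\mid l\in L\}$. For a $B_K$-group $(L,\varphi)$ let $\mathsf{e}_{L,\varphi}^0=\sum\mathsf{e}_{M,\psi}$, the sum over all $B_K$-groups $(M,\psi)$ with $(M,\psi)\twoheadrightarrow(L,\varphi)$ and $(M,\psi)\not\cong(L,\varphi)$, and let $S_{L,\varphi}=\mathsf{e}_{L,\varphi}/\mathsf{e}_{L,\varphi}^0$.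 A minimal group for $S_{L,\varphi}$ is a finite group $G$ of minimal order such that $S_{L,\varphi}(G)\neq\{0\}$. **Theorem.** Let $(L,\varphi)$ be a $B_K$-group and $G$ a finite group. The following are equivalent: 1. $G$ is a minimal group for $S_{L,\varphi}$. 2. $G\cong L/N$, where $N$ is a normal subgroup of $L$ of maximal order such that $N\cap\ker\varphi=\mathbf 1$. Moreover, in this case, the images in $S_{L,\varphi}(G)$ of the idempotents $e_X^{G\times K}$, where $X$ runs through any set of representatives of the conjugacy classes of subgroups of $G\times K$ such that $(X,p_2)\cong(L,\varphi)$ as groups over $K$, form an $\mathbb{F}$-basis of $S_{L,\varphi}(G)$. -/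

import Mathlib

universe u v w

noncomputable section

namespace ShiftedBurnside

/-! ### Finite `G`-sets and the Burnside functor -/

/-- A finite left `G`-set. -/
structure FinGSet (G : Type u) [Group G] : Type (u + 1) where
  carrier : Type u
  [action : MulAction G carrier]
  [finite : Finite carrier]

attribute [instance] FinGSet.action FinGSet.finite

/-- Isomorphism of `G`-sets. -/
def FinGSet.Iso {G : Type u} [Group G] (X Y : FinGSet G) : Prop :=
  ∃ f : X.carrier ≃ Y.carrier, ∀ (g : G) (x : X.carrier), f (g • x) = g • f x

/-- The disjoint union of two finite `G`-sets. -/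
def FinGSet.disjUnion {G : Type u} [Group G] (X Y : FinGSet G) : FinGSet G where
  carrier := X.carrier ⊕ Y.carrier

/-- The relations `[X] = [Y]` for `X ≅ Y` and `[X ⊔ Y] = [X] + [Y]` defining the Burnside group. -/
def burnsideRelations (F : Type v) [Field F] (G : Type u) [Group G] :
    Submodule F (FinGSet G →₀ F) :=
  Submodule.span F
    ({r | ∃ X Y : FinGSet G, X.Iso Y ∧ r = Finsupp.single X 1 - Finsupp.single Y 1} ∪
     {r | ∃ X Y : FinGSet G,
        r = Finsupp.single (X.disjUnion Y) 1 - Finsupp.single X 1 - Finsupp.single Y 1})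

/-- `𝔽B(G) = 𝔽 ⊗ B(G)`, where `B(G)` is the Grothendieck group of finite `G`-sets for disjoint
union, presented by generators and relations. -/
abbrev FB (F : Type v) [Field F] (G : Type u) [Group G] : Type (max (u + 1) v) :=
  (FinGSet G →₀ F) ⧸ burnsideRelations F G

section Burnside

variable {F : Type v} [Field F]

/-- The class `[X]` in `𝔽B(G)` of a finite `G`-set. -/
def cls (F : Type v) [Field F] {G : Type u} [Group G] (X : FinGSet G) : FB F G :=
  (burnsideRelations F G).mkQ (Finsupp.single X 1)

theorem cls_iso {G : Type u} [Group G] {X Y : FinGSet G} (h : X.Iso Y) :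
    cls F X = cls F Y := by
  rw [cls, cls, ← sub_eq_zero, ← map_sub, Submodule.mkQ_apply, Submodule.Quotient.mk_eq_zero]
  exact Submodule.subset_span (Or.inl ⟨X, Y, h, rfl⟩)

theorem cls_disjUnion {G : Type u} [Group G] (X Y : FinGSet G) :
    cls F (X.disjUnion Y) = cls F X + cls F Y := by
  rw [cls, cls, cls, ← sub_eq_zero, ← sub_sub, ← map_sub, ← map_sub, Submodule.mkQ_apply,
    Submodule.Quotient.mk_eq_zero]
  exact Submodule.subset_span (Or.inr ⟨X, Y, rfl⟩)

/-- The linear map on `𝔽B(G)` induced by an additive invariant of finite `G`-sets. -/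
def FB.lift {G : Type u} [Group G] {V : Type w} [AddCommGroup V] [Module F V]
    (f : FinGSet G → V) (hiso : ∀ X Y : FinGSet G, X.Iso Y → f X = f Y)
    (hadd : ∀ X Y : FinGSet G, f (X.disjUnion Y) = f X + f Y) : FB F G →ₗ[F] V :=
  (burnsideRelations F G).liftQ (Finsupp.linearCombination F f) (by
    rw [burnsideRelations, Submodule.span_le]
    rintro r (⟨X, Y, h, rfl⟩ | ⟨X, Y, rfl⟩)
    · simp [hiso X Y h]
    · simp [hadd X Y])

theorem FB.lift_cls {G : Type u} [Group G] {V : Type w} [AddCommGroup V] [Module F V]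
    (f : FinGSet G → V) (hiso : ∀ X Y : FinGSet G, X.Iso Y → f X = f Y)
    (hadd : ∀ X Y : FinGSet G, f (X.disjUnion Y) = f X + f Y) (X : FinGSet G) :
    FB.lift (F := F) f hiso hadd (cls F X) = f X := by
  simp [FB.lift, cls]

theorem FB.hom_ext {G : Type u} [Group G] {V : Type w} [AddCommGroup V] [Module F V]
    {f g : FB F G →ₗ[F] V} (h : ∀ X : FinGSet G, f (cls F X) = g (cls F X)) : f = g := by
  apply Submodule.linearMap_qext
  apply Finsupp.lhom_ext'
  intro X
  apply LinearMap.ext_ring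
  exact h X

end Burnside

/-! ### Bisets -/

/-- A finite `(H, G)`-biset: commuting left `H`-action and right `G`-action. -/
structure Biset (H G : Type u) [Group H] [Group G] : Type (u + 1) where
  carrier : Type u
  [left : MulAction H carrier]
  [right : MulAction Gᵐᵒᵖ carrier]
  [comm : SMulCommClass H Gᵐᵒᵖ carrier]
  [finite : Finite carrier]

attribute [instance] Biset.left Biset.right Biset.comm Biset.finite

namespace Biset

variable {H G : Type u} [Group H] [Group G]

/-- The orbit relation of the right action `(u, x) · g = (u g, g⁻¹ x)` of `G` on `U × X`. -/
def tensorSetoid (U : Biset H G) (X : FinGSet G) : Setoid (U.carrier × X.carrier) where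
  r p q := ∃ g : G, q = (MulOpposite.op g • p.1, g⁻¹ • p.2)
  iseqv :=
    { refl := fun p => ⟨1, by simp⟩
      symm := by
        rintro p q ⟨g, rfl⟩
        exact ⟨g⁻¹, by simp [smul_smul]⟩
      trans := by
        rintro p q r ⟨g, rfl⟩ ⟨g', rfl⟩
        exact ⟨g * g', by simp [smul_smul]⟩ }

/-- The finite `H`-set `U ×_G X`. -/
def tensor (U : Biset H G) (X : FinGSet G) : FinGSet H where
  carrier := Quotient (U.tensorSetoid X)
  action :=
    { smul := fun h => Quotient.map (fun p => (h • p.1, p.2)) (by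
        rintro p q ⟨g, rfl⟩
        exact ⟨g, by simp [smul_comm]⟩)
      one_smul := by
        rintro ⟨p⟩
        exact congrArg (Quotient.mk _) (Prod.ext (one_smul _ _) rfl)
      mul_smul := by
        rintro h h' ⟨p⟩
        exact congrArg (Quotient.mk _) (Prod.ext (mul_smul _ _ _) rfl) }
  finite := Quotient.finite _

theorem tensor_iso (U : Biset H G) {X Y : FinGSet G} (h : X.Iso Y) :
    (U.tensor X).Iso (U.tensor Y) := by
  obtain ⟨f, hf⟩ := h
  refine ⟨Quotient.congr (ra := U.tensorSetoid X) (rb := U.tensorSetoid Y)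
    (Equiv.prodCongr (Equiv.refl _) f) ?_, ?_⟩
  · rintro ⟨a, x⟩ ⟨b, y⟩
    constructor
    · rintro ⟨g, hg⟩
      refine ⟨g, ?_⟩
      simp only [Prod.mk.injEq] at hg
      simp [hg.1, hg.2, hf]
    · rintro ⟨g, hg⟩
      refine ⟨g, ?_⟩
      simp only [Equiv.prodCongr_apply, Prod.map_apply, Equiv.refl_apply, Prod.mk.injEq,
        ← hf, EmbeddingLike.apply_eq_iff_eq] at hg
      simp [hg.1, hg.2]
  · rintro h ⟨p⟩
    rfl

theorem tensor_disjUnion (U : Biset H G) (X Y : FinGSet G) :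
    (U.tensor (X.disjUnion Y)).Iso ((U.tensor X).disjUnion (U.tensor Y)) := by
  refine ⟨⟨Quotient.lift (s := U.tensorSetoid (X.disjUnion Y))
      (fun p => Sum.elim
        (fun x => Sum.inl (Quotient.mk (U.tensorSetoid X) (p.1, x)))
        (fun y => Sum.inr (Quotient.mk (U.tensorSetoid Y) (p.1, y))) p.2) ?_,
      Sum.elim
        (Quotient.map (sa := U.tensorSetoid X) (sb := U.tensorSetoid (X.disjUnion Y))
          (fun p => (p.1, Sum.inl p.2)) ?_)
        (Quotient.map (sa := U.tensorSetoid Y) (sb := U.tensorSetoid (X.disjUnion Y))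
          (fun p => (p.1, Sum.inr p.2)) ?_), ?_, ?_⟩, ?_⟩
  · rintro ⟨a, x | x⟩ q ⟨g, rfl⟩
    · exact congrArg Sum.inl (Quotient.sound ⟨g, rfl⟩)
    · exact congrArg Sum.inr (Quotient.sound ⟨g, rfl⟩)
  · rintro p q ⟨g, rfl⟩
    exact ⟨g, rfl⟩
  · rintro p q ⟨g, rfl⟩
    exact ⟨g, rfl⟩
  · rintro ⟨a, x | x⟩ <;> rfl
  · rintro (⟨a, x⟩ | ⟨a, x⟩) <;> rfl
  · rintro h ⟨a, x | x⟩ <;> rfl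

/-- The map `𝔽B(U) : 𝔽B(G) → 𝔽B(H)`, `[X] ↦ [U ×_G X]`. -/
def map (F : Type v) [Field F] (U : Biset H G) : FB F G →ₗ[F] FB F H :=
  FB.lift (fun X => cls F (U.tensor X)) (fun _ _ h => cls_iso (U.tensor_iso h))
    (fun X Y => by rw [cls_iso (U.tensor_disjUnion X Y), cls_disjUnion])

/-- `U × K` as an `(H × K, G × K)`-biset, `K` acting on the left and on the right on the second
component by multiplication. -/
def shift (K : Type u) [Group K] [Finite K] (U : Biset H G) : Biset (H × K) (G × K) :=
  letI actL : MulAction (H × K) (U.carrier × K) :=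
    { smul := fun a p => (a.1 • p.1, a.2 * p.2)
      one_smul := fun p => Prod.ext (one_smul H p.1) (one_mul p.2)
      mul_smul := fun a b p => Prod.ext (mul_smul a.1 b.1 p.1) (mul_assoc a.2 b.2 p.2) }
  letI actR : MulAction (G × K)ᵐᵒᵖ (U.carrier × K) :=
    { smul := fun a p => (MulOpposite.op a.unop.1 • p.1, p.2 * a.unop.2)
      one_smul := fun p => Prod.ext (one_smul Gᵐᵒᵖ p.1) (mul_one p.2)
      mul_smul := fun a b p => Prod.ext
        (mul_smul (MulOpposite.op a.unop.1) (MulOpposite.op b.unop.1) p.1)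
        (mul_assoc p.2 b.unop.2 a.unop.2).symm }
  { carrier := U.carrier × K
    left := actL
    right := actR
    comm := ⟨fun a b p => Prod.ext (smul_comm a.1 (MulOpposite.op b.unop.1) p.1)
      (mul_assoc a.2 p.2 b.unop.2).symm⟩ }

end Biset

/-! ### Products -/

section Products

variable {G H : Type u} [Group G] [Group H]

/-- The `(G × H)`-set `X × Y`. -/
def FinGSet.extProd (X : FinGSet G) (Y : FinGSet H) : FinGSet (G × H) where
  carrier := X.carrier × Y.carrier
  action :=
    { smul := fun a p => (a.1 • p.1, a.2 • p.2)
      one_smul := fun p => Prod.ext (one_smul G p.1) (one_smul H p.2)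
      mul_smul := fun a b p => Prod.ext (mul_smul a.1 b.1 p.1) (mul_smul a.2 b.2 p.2) }

/-- The `H`-set obtained from a `G`-set by letting `H` act through `f : H → G`. -/
def FinGSet.res (f : H →* G) (X : FinGSet G) : FinGSet H where
  carrier := X.carrier
  action := MulAction.compHom X.carrier f

/-- The bilinear product `𝔽B(G) × 𝔽B(H) → 𝔽B(G × H)`, `[X] × [Y] = [X × Y]`. -/
def extProd (F : Type v) [Field F] : FB F G →ₗ[F] FB F H →ₗ[F] FB F (G × H) :=
  FB.lift
    (fun X => FB.lift (fun Y => cls F (X.extProd Y))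
      (fun Y Y' ⟨f, hf⟩ => cls_iso ⟨Equiv.prodCongr (Equiv.refl _) f,
        fun a p => Prod.ext rfl (hf a.2 p.2)⟩)
      (fun Y Y' => by
        rw [← cls_disjUnion]
        refine cls_iso ⟨Equiv.prodSumDistrib _ _ _, ?_⟩
        rintro a ⟨x, y | y⟩ <;> rfl))
    (fun X X' ⟨f, hf⟩ => FB.hom_ext fun Y => by
      rw [FB.lift_cls, FB.lift_cls]
      exact cls_iso ⟨Equiv.prodCongr f (Equiv.refl _), fun a p => Prod.ext (hf a.1 p.1) rfl⟩)
    (fun X X' => FB.hom_ext fun Y => by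
      rw [LinearMap.add_apply, FB.lift_cls, FB.lift_cls, FB.lift_cls, ← cls_disjUnion]
      refine cls_iso ⟨Equiv.sumProdDistrib _ _ _, ?_⟩
      rintro a ⟨x | x, y⟩ <;> rfl)

/-- Restriction along a group homomorphism `f : H → G`. If `f` is injective with image `Δ`, this is
`Iso(δ) ∘ Res_Δ^G`, where `δ : Δ → H` is the inverse of `f`. -/
def resHom (F : Type v) [Field F] (f : H →* G) : FB F G →ₗ[F] FB F H :=
  FB.lift (fun X => cls F (X.res f))
    (fun _ _ ⟨e, he⟩ => cls_iso ⟨e, fun h x => he (f h) x⟩)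
    (fun X Y => by
      rw [← cls_disjUnion]
      refine cls_iso ⟨Equiv.refl _, ?_⟩
      rintro h (x | x) <;> rfl)

/-- The embedding `G × H × K → G × K × H × K`, `(g, h, k) ↦ (g, k, h, k)`. -/
def diagEmb (G H K : Type u) [Group G] [Group H] [Group K] :
    (G × H) × K →* (G × K) × (H × K) where
  toFun a := ((a.1.1, a.2), (a.1.2, a.2))
  map_one' := rfl
  map_mul' _ _ := rfl

/-- The product `𝔽B_K(G) × 𝔽B_K(H) → 𝔽B_K(G × H)` of the shifted Burnside functor,
where `𝔽B_K(G) = 𝔽B(G × K)`. -/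
def shiftProd (F : Type v) [Field F] (K : Type u) [Group K]
    (α : FB F (G × K)) (β : FB F (H × K)) : FB F ((G × H) × K) :=
  resHom F (diagEmb G H K) (extProd F α β)

end Products

/-! ### Ideals of the Green biset functor `𝔽B_K` -/

/-- A (left) ideal of `𝔽B_K`: a family of subspaces `I(G) ⊆ 𝔽B_K(G) = 𝔽B(G × K)`, for all finite
groups `G`, stable under the maps `𝔽B_K(U) = 𝔽B(U × K)` for all finite bisets `U`, and under
products `𝔽B_K(G) × I(H) → I(G × H)`. -/
structure GreenIdeal (F : Type v) [Field F] (K : Type u) [Group K] [Finite K] where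
  carrier : (G : Type u) → [Group G] → [Finite G] → Submodule F (FB F (G × K))
  map_mem : ∀ (G H : Type u) [Group G] [Finite G] [Group H] [Finite H] (U : Biset H G)
    (a : FB F (G × K)), a ∈ carrier G → (U.shift K).map F a ∈ carrier H
  prod_mem : ∀ (G H : Type u) [Group G] [Finite G] [Group H] [Finite H]
    (α : FB F (G × K)) (β : FB F (H × K)), β ∈ carrier H → shiftProd F K α β ∈ carrier (G × H)

namespace GreenIdeal

variable {F : Type v} [Field F] {K : Type u} [Group K] [Finite K]

/-- The ideal of `𝔽B_K` generated by an element `a` of `𝔽B_K(L)`: the intersection of all the ideals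
containing it. -/
def gen {L : Type u} [Group L] [Finite L] (a : FB F (L × K)) : GreenIdeal F K where
  carrier G _ _ := ⨅ I : {I : GreenIdeal F K // a ∈ I.carrier L}, I.1.carrier G
  map_mem G H _ _ _ _ U b hb := by
    rw [Submodule.mem_iInf] at hb ⊢
    exact fun I => I.1.map_mem G H U b (hb I)
  prod_mem G H _ _ _ _ α β hβ := by
    rw [Submodule.mem_iInf] at hβ ⊢
    exact fun I => I.1.prod_mem G H α β (hβ I)

/-- The sum of a family of ideals of `𝔽B_K`. -/
def sum {ι : Type w} (J : ι → GreenIdeal F K) : GreenIdeal F K where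
  carrier G _ _ := ⨆ i, (J i).carrier G
  map_mem G H _ _ _ _ U b hb := by
    have h : (⨆ i, (J i).carrier G) ≤
        (⨆ i, (J i).carrier H).comap ((U.shift K).map F) :=
      iSup_le fun i x hx => Submodule.mem_iSup_of_mem i ((J i).map_mem G H U x hx)
    exact h hb
  prod_mem G H _ _ _ _ α β hβ := by
    have h : (⨆ i, (J i).carrier H) ≤
        (⨆ i, (J i).carrier (G × H)).comap (resHom F (diagEmb G H K) ∘ₗ extProd F α) :=
      iSup_le fun i x hx => Submodule.mem_iSup_of_mem i ((J i).prod_mem G H α x hx)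
    exact h hβ

end GreenIdeal

/-! ### Idempotents -/

/-- The Möbius function `μ(X, Y)` of the poset of subgroups of a finite group `G`. -/
def subgroupMoebius {G : Type u} [Group G] [Finite G] (X Y : Subgroup G) : ℤ := by
  classical
  exact
    letI : Fintype (Subgroup G) := Fintype.ofFinite _
    letI : LocallyFiniteOrder (Subgroup G) := Fintype.toLocallyFiniteOrder
    IncidenceAlgebra.mu ℤ X Y

/-- The transitive `G`-set `G / X`. -/
def cosetSet {G : Type u} [Group G] [Finite G] (X : Subgroup G) : FinGSet G where
  carrier := G ⧸ X

/-- The idempotent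
`e_L^G = |N_G(L)|⁻¹ ∑_{X ≤ L} |X| μ(X, L) [G / X]` of `𝔽B(G)`. -/
def idem (F : Type v) [Field F] {G : Type u} [Group G] [Finite G] (L : Subgroup G) : FB F G :=
  (Nat.card (Subgroup.normalizer (L : Set G)) : F)⁻¹ •
    ∑ᶠ (X : Subgroup G) (_ : X ≤ L),
      ((Nat.card X : F) * (subgroupMoebius X L : F)) • cls F (cosetSet X)

/-- `m_{L,N} = |L|⁻¹ ∑_{X ≤ L, X N = L} |X| μ(X, L)`, for `N` normal in `L` (so that `X N` is the
subgroup generated by `X` and `N`). -/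
def mNumber {L : Type u} [Group L] [Finite L] (N : Subgroup L) : ℚ :=
  (Nat.card L : ℚ)⁻¹ *
    ∑ᶠ (X : Subgroup L) (_ : X ⊔ N = ⊤), (Nat.card X : ℚ) * (subgroupMoebius X ⊤ : ℚ)

/-! ### Groups over `K` -/

section Over

variable {K : Type u} [Group K]

/-- `f : L → M` is a morphism `(L, φ) → (M, ψ)` of groups over `K`: `i ∘ φ = ψ ∘ f` for some inner
automorphism `i` of `K`. -/
def IsOverHom {L M : Type u} [Group L] [Group M] (φ : L →* K) (ψ : M →* K) (f : L →* M) : Prop :=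
  ∃ k : K, ∀ l : L, MulAut.conj k (φ l) = ψ (f l)

/-- `(L, φ) ↠ (M, ψ)`: `(M, ψ)` is a quotient of `(L, φ)`. -/
def OverQuotient {L M : Type u} [Group L] [Group M] (φ : L →* K) (ψ : M →* K) : Prop :=
  ∃ f : L →* M, Function.Surjective f ∧ IsOverHom φ ψ f

/-- `(L, φ)` and `(M, ψ)` are isomorphic as groups over `K`. -/
def OverIso {L M : Type u} [Group L] [Group M] (φ : L →* K) (ψ : M →* K) : Prop :=
  ∃ (f : L →* M) (g : M →* L), IsOverHom φ ψ f ∧ IsOverHom ψ φ g ∧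
    g.comp f = MonoidHom.id L ∧ f.comp g = MonoidHom.id M

/-- `(L, φ)` is a `B_K`-group: `m_{L,N} = 0` for every non-trivial normal subgroup `N` of `L`
contained in `ker φ`. -/
def IsBGroup {L : Type u} [Group L] [Finite L] (φ : L →* K) : Prop :=
  ∀ N : Subgroup L, N.Normal → N ≤ φ.ker → N ≠ ⊥ → mNumber N = 0

/-- The subgroup `L_φ = {(l, φ(l)) | l ∈ L}` of `L × K`. -/
def graphSubgroup {L : Type u} [Group L] (φ : L →* K) : Subgroup (L × K) :=
  ((MonoidHom.id L).prod φ).range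

/-- The restriction `p₂ : X → K` of the second projection to a subgroup `X` of `G × K`. -/
def p2 {G : Type u} [Group G] (X : Subgroup (G × K)) : X →* K :=
  (MonoidHom.snd G K).comp X.subtype

end Over

/-! ### The ideals `e_{L,φ}`, `e⁰_{L,φ}` and the simple module `S_{L,φ}` -/

section Simple

variable (F : Type v) [Field F] {K : Type u} [Group K] [Finite K]

/-- The ideal `e_{L,φ}` of `𝔽B_K` generated by `e_{L_φ}^{L × K} ∈ 𝔽B_K(L)`. -/
def eIdeal {L : Type u} [Group L] [Finite L] (φ : L →* K) : GreenIdeal F K :=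
  GreenIdeal.gen (idem F (graphSubgroup φ))

/-- The `B_K`-groups `(M, ψ)` with `(M, ψ) ↠ (L, φ)` but `(M, ψ) ≇ (L, φ)`. -/
structure ProperBCover {L : Type u} [Group L] (φ : L →* K) : Type (u + 1) where
  M : Type u
  [grp : Group M]
  [fin : Finite M]
  ψ : M →* K
  isBGroup : IsBGroup ψ
  quotient : OverQuotient ψ φ
  not_iso : ¬ OverIso ψ φ

attribute [instance] ProperBCover.grp ProperBCover.fin

/-- `e⁰_{L,φ} = ∑ e_{M,ψ}`, over the `B_K`-groups `(M, ψ) ↠ (L, φ)` with `(M, ψ) ≇ (L, φ)`. -/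
def eIdeal0 {L : Type u} [Group L] [Finite L] (φ : L →* K) : GreenIdeal F K :=
  GreenIdeal.sum fun c : ProperBCover φ => eIdeal F c.ψ

/-- The evaluation `S_{L,φ}(G) = e_{L,φ}(G) / e⁰_{L,φ}(G)`. -/
abbrev SEval {L : Type u} [Group L] [Finite L] (φ : L →* K)
    (G : Type u) [Group G] [Finite G] : Type (max (u + 1) v) :=
  (eIdeal F φ).carrier G ⧸ ((eIdeal0 F φ).carrier G).submoduleOf ((eIdeal F φ).carrier G)

/-- The projection `e_{L,φ}(G) → S_{L,φ}(G)`. -/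
def SProj {L : Type u} [Group L] [Finite L] (φ : L →* K)
    (G : Type u) [Group G] [Finite G] : (eIdeal F φ).carrier G →ₗ[F] SEval F φ G :=
  (((eIdeal0 F φ).carrier G).submoduleOf ((eIdeal F φ).carrier G)).mkQ

end Simple

/-- `G` is a minimal group for the functor `V` (given by its evaluations): `V(G) ≠ 0`, and `G` has
minimal order among the finite groups with this property. -/
def IsMinimalGroup (V : (G : Type u) → [Group G] → [Finite G] → Type w)
    (G : Type u) [Group G] [Finite G] : Prop :=
  Nontrivial (V G) ∧ ∀ (H : Type u) [Group H] [Finite H], Nontrivial (V H) →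
    Nat.card G ≤ Nat.card H

/-- `N` is a normal subgroup of `L` with `N ∩ ker φ = 1`, of maximal order among these. -/
def IsMaxNormalAvoidingKer {L K : Type u} [Group L] [Group K] (φ : L →* K)
    (N : Subgroup L) : Prop :=
  N.Normal ∧ N ⊓ φ.ker = ⊥ ∧
    ∀ N' : Subgroup L, N'.Normal → N' ⊓ φ.ker = ⊥ → Nat.card N' ≤ Nat.card N

/-- `R` is a set of representatives of the conjugacy classes of the subgroups of `Γ` with the
property `P`. -/
def IsConjReps {Γ : Type u} [Group Γ] (P : Subgroup Γ → Prop) (R : Set (Subgroup Γ)) : Prop :=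
  (∀ X ∈ R, P X) ∧
    ∀ Y : Subgroup Γ, P Y → ∃! X : Subgroup Γ,
      X ∈ R ∧ ∃ g : Γ, X = Y.map (MulAut.conj g).toMonoidHom

end ShiftedBurnside

end

namespace ShiftedBurnside

/-! ### Möbius functions of finite posets -/

section Moebius

/-! Elements of `𝔽B(Γ)` are determined by their marks `|S^Y|`, and `e_X` has mark 1 on the
conjugates of `X` and 0 elsewhere (`mark_idem`, `mark_ext`). An ideal of `𝔽B_K` is closed under
multiplication in `𝔽B_K(G)`, obtained by restricting products to the diagonal, so it contains `e_Z`
as soon as one of its elements has nonzero mark at `Z`. The core is `mem_eIdeal_iff`: for a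
`B_K`-group `(L, φ)`, the space `e_{L,φ}(G)` is spanned by the `e_Z` with `(Z, p₂) ↠ (L, φ)`.

Both inclusions rest on `mark_map_idem`. Up to a nonzero factor, the mark at `Z` of the image of
`e_A` under a biset is the sum of `|N_w| m_{A,N_w}` over the points `w` with `Zw = wA`, where `N_w`
is the stabilizer of `w` in `A`. For a biset `U × K`, the group `N_w` lies in the kernel of the map
to `K`, since `K` acts freely on itself. If `(A, p₂) ↠ (L, φ)` and `m_{A,N_w} ≠ 0`, then some
surjection from `A` to `L` over `K` kills `N_w` (`exists_overHom_of_mNumber_ne_zero`). As `Z` maps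
onto `A/N_w`, it maps onto `L`; hence the support condition defines an ideal. Conversely, if `(Z,
p₂) ↠ (L, φ)`, the `B_K`-condition makes every term nonnegative when `A = L_φ`, and a suitable
transitive biset has a positive term, so `e_Z` is reached.

Minimality is then a count. A surjection `f` from `Z ≤ G × K` to `L` over `K` is injective on `Z ∩
(G × 1)`, whose image `N` is normal in `L` and meets `ker φ` trivially; so `|L| ≤ |Z| ≤ |G||N|`. If
`|G|` is `|L|` divided by the largest possible `|N|`, equality holds throughout, so `Z ≅ L` over `K`
and `G ≅ L/N`. In that case no proper cover of `L` contributes, `e⁰_{L,φ}(G) = 0`, and the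
idempotents give a basis of `S_{L,φ}(G) = e_{L,φ}(G)`. -/

open Classical in
/-- A function on a finite meet-semilattice whose sums over the upper sets of the elements below `t`
vanish has vanishing sums over the fibres of `(· ⊓ t)` (Weisner's theorem). -/
theorem sum_inf_fibre_eq_zero {α R : Type*} [SemilatticeInf α] [Fintype α] [AddCommGroup R]
    (f : α → R) (t : α) (hf : ∀ a ≤ t, ∑ x, (if a ≤ x then f x else 0) = 0) :
    ∀ a ≤ t, ∑ x, (if x ⊓ t = a then f x else 0) = 0 := by
  intro a
  induction a using WellFoundedGT.induction with
  | _ a ih =>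
    intro hat
    have h1 := hf a hat
    have h2 : ∑ x, (if a ≤ x then f x else 0) =
        ∑ b, if a ≤ b then ∑ x, (if x ⊓ t = b then f x else 0) else 0 := by
      simp_rw [← Finset.sum_filter]
      rw [Finset.sum_comm' (t' := Finset.univ.filter fun x => a ≤ x) (s' := fun x => {x ⊓ t})]
      · simp
      · intro b x
        simp only [Finset.mem_filter, Finset.mem_univ, true_and, Finset.mem_singleton]
        constructor
        · rintro ⟨h, rfl⟩; exact ⟨rfl, h.trans inf_le_left⟩
        · rintro ⟨rfl, h⟩; exact ⟨le_inf h hat, rfl⟩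
    rw [h2, Finset.sum_eq_single a] at h1
    · simpa using h1
    · intro b _ hb
      split_ifs with hab
      · by_cases hbt : b ≤ t
        · exact ih b (lt_of_le_of_ne hab hb.symm) hbt
        · refine Finset.sum_eq_zero fun x _ => if_neg ?_
          rintro rfl
          exact hbt inf_le_right
      · rfl
    · simp

-- Weisner's theorem with weights: a weight depending only on `x ⊓ t` is constant on the fibres,
-- each of which has sum zero.
open Classical in
theorem sum_mul_comp_inf_eq_zero {α R : Type*} [SemilatticeInf α] [Fintype α] [Ring R]
    (f g : α → R) (t : α) (hf : ∀ a ≤ t, ∑ x, (if a ≤ x then f x else 0) = 0) :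
    ∑ x, f x * g (x ⊓ t) = 0 := by
  rw [← Finset.sum_fiberwise Finset.univ (fun x => x ⊓ t)]
  refine Finset.sum_eq_zero fun a _ => ?_
  have h : ∑ x with x ⊓ t = a, f x * g (x ⊓ t) = (∑ x, if x ⊓ t = a then f x else 0) * g a := by
    rw [← Finset.sum_filter, Finset.sum_mul]
    refine Finset.sum_congr rfl fun x hx => ?_
    rw [(Finset.mem_filter.1 hx).2]
  rw [h]
  by_cases hat : a ≤ t
  · rw [sum_inf_fibre_eq_zero f t hf a hat, zero_mul]
  · rw [Finset.sum_eq_zero, zero_mul]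
    refine fun x _ => if_neg ?_
    rintro rfl
    exact hat inf_le_right

variable {G : Type u} [Group G] [Finite G]

theorem subgroupMoebius_of_not_le {X Y : Subgroup G} (h : ¬ X ≤ Y) : subgroupMoebius X Y = 0 := by
  classical
  exact IncidenceAlgebra.apply_eq_zero_of_not_le h _

@[simp]
theorem subgroupMoebius_self (X : Subgroup G) : subgroupMoebius X X = 1 := by
  classical
  simp [subgroupMoebius]

open Classical in
theorem subgroupMoebius_eq_mu [LocallyFiniteOrder (Subgroup G)] (X Y : Subgroup G) :
    subgroupMoebius X Y = IncidenceAlgebra.mu ℤ X Y := by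
  unfold subgroupMoebius
  congr!
  exact Subsingleton.elim _ _

variable [Fintype (Subgroup G)]

open Classical in
theorem sum_subgroupMoebius_left (Y X : Subgroup G) :
    ∑ V : Subgroup G, (if Y ≤ V then subgroupMoebius V X else 0) = if Y = X then 1 else 0 := by
  let : LocallyFiniteOrder (Subgroup G) := Fintype.toLocallyFiniteOrder
  have h := IncidenceAlgebra.sum_Icc_mu_left (𝕜 := ℤ) Y X
  simp_rw [← subgroupMoebius_eq_mu] at h
  refine Eq.trans ?_ h
  rw [← Finset.sum_filter]
  symm
  refine Finset.sum_subset (fun V hV => ?_) fun V hV hV' => ?_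
  · simpa using (Finset.mem_Icc.1 hV).1
  · refine subgroupMoebius_of_not_le fun h => hV' ?_
    simp only [Finset.mem_filter] at hV
    exact Finset.mem_Icc.2 ⟨hV.2, h⟩

open Classical in
theorem sum_subgroupMoebius_right (Y X : Subgroup G) :
    ∑ V : Subgroup G, (if V ≤ X then subgroupMoebius Y V else 0) = if Y = X then 1 else 0 := by
  let : LocallyFiniteOrder (Subgroup G) := Fintype.toLocallyFiniteOrder
  have h := IncidenceAlgebra.sum_Icc_mu_right (𝕜 := ℤ) Y X
  simp_rw [← subgroupMoebius_eq_mu] at h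
  refine Eq.trans ?_ h
  rw [← Finset.sum_filter]
  symm
  refine Finset.sum_subset (fun V hV => ?_) fun V hV hV' => ?_
  · simpa using (Finset.mem_Icc.1 hV).2
  · refine subgroupMoebius_of_not_le fun h => hV' ?_
    simp only [Finset.mem_filter] at hV
    exact Finset.mem_Icc.2 ⟨h, hV.2⟩

theorem sum_subgroupMoebius_mul_inf_eq_zero {R : Type*} [Ring R] (X T : Subgroup G)
    (hT : ¬ X ≤ T) (g : Subgroup G → R) :
    ∑ Y : Subgroup G, (subgroupMoebius Y X : R) * g (Y ⊓ T) = 0 := by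
  classical
  refine sum_mul_comp_inf_eq_zero (fun Y : Subgroup G => (subgroupMoebius Y X : R)) g T fun a ha => ?_
  have h := sum_subgroupMoebius_left a X
  rw [if_neg (by rintro rfl; exact hT ha)] at h
  have := congrArg (Int.cast : ℤ → R) h
  rw [Int.cast_sum] at this
  simpa [apply_ite (Int.cast : ℤ → R)] using this

-- If `Q ≤ Z`, only `X = ⊤` can contribute, since `Z ≤ X` already gives `Q ≤ X`. Otherwise this is
-- Weisner's theorem in the opposite lattice, where joining with `Q` becomes the meet.
open Classical in
theorem sum_subgroupMoebius_sup_eq_top (Z Q : Subgroup G) :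
    ∑ X : Subgroup G, (if X ⊔ Q = ⊤ then subgroupMoebius Z X else 0) =
      if Q ≤ Z then subgroupMoebius Z ⊤ else 0 := by
  split_ifs with hQ
  · rw [Finset.sum_eq_single ⊤ _ (by simp)]
    · simp
    intro X _ hX
    split_ifs with h
    · refine subgroupMoebius_of_not_le fun hZ => hX ?_
      rwa [sup_eq_left.2 (hQ.trans hZ)] at h
    · rfl
  · have := sum_inf_fibre_eq_zero (α := (Subgroup G)ᵒᵈ)
      (fun X => subgroupMoebius Z (OrderDual.ofDual X)) (OrderDual.toDual Q)
      (fun a ha => ?_) (OrderDual.toDual ⊤) (le_top (α := Subgroup G))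
    · exact this
    · have h := sum_subgroupMoebius_right Z (OrderDual.ofDual a)
      rw [if_neg (by rintro rfl; exact hQ ha)] at h
      exact h

/-- The value `μ(Y, X)` depends only on the interval from `Y` to `X`, and `hι` says that `ι` fills
the corresponding interval. The proof compares the two recursions, descending from the larger
subgroups to `Y`. -/
theorem subgroupMoebius_orderEmbedding {H : Type v} [Group H] [Finite H]
    (ι : Subgroup H ↪o Subgroup G) (X : Subgroup H)
    (hι : ∀ Y V, ι Y ≤ V → V ≤ ι X → V ∈ Set.range ι) (Y : Subgroup H) :
    subgroupMoebius (ι Y) (ι X) = subgroupMoebius Y X := by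
  classical
  let : Fintype (Subgroup H) := Fintype.ofFinite _
  induction Y using WellFoundedGT.induction with
  | _ Y ih =>
    have h1 := sum_subgroupMoebius_left (ι Y) (ι X)
    have h2 := sum_subgroupMoebius_left Y X
    rw [← Finset.sum_filter] at h1 h2
    have h3 : ∑ V with ι Y ≤ V, subgroupMoebius V (ι X) =
        ∑ V with Y ≤ V, subgroupMoebius (ι V) (ι X) := by
      symm
      refine (Finset.sum_map _ ι.toEmbedding (fun V => subgroupMoebius V (ι X))).symm.trans ?_
      refine Finset.sum_subset (fun V hV => ?_) fun V hV hV' => ?_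
      · simp only [Finset.mem_map, Finset.mem_filter, Finset.mem_univ, true_and] at hV ⊢
        obtain ⟨V, h, rfl⟩ := hV
        exact ι.le_iff_le.2 h
      · refine subgroupMoebius_of_not_le fun h => hV' ?_
        simp only [Finset.mem_map, Finset.mem_filter, Finset.mem_univ, true_and] at hV ⊢
        obtain ⟨V, rfl⟩ := hι Y V hV h
        exact ⟨V, ι.le_iff_le.1 hV, rfl⟩
    have hmem : Y ∈ Finset.univ.filter fun V => Y ≤ V := by simp
    rw [h3, ← Finset.add_sum_erase _ _ hmem] at h1
    rw [← Finset.add_sum_erase _ _ hmem] at h2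
    rw [Finset.sum_congr rfl (g := fun V => subgroupMoebius V X)] at h1
    · simp only [EmbeddingLike.apply_eq_iff_eq] at h1
      linarith
    · intro V hV
      simp only [Finset.mem_erase, Finset.mem_filter, Finset.mem_univ, true_and] at hV
      exact ih V (lt_of_le_of_ne hV.2 hV.1.symm)

theorem subgroupMoebius_map {H : Type v} [Group H] [Finite H] {ι : H →* G}
    (hι : Function.Injective ι) (Y X : Subgroup H) :
    subgroupMoebius (Y.map ι) (X.map ι) = subgroupMoebius Y X := by
  refine subgroupMoebius_orderEmbedding
    (OrderEmbedding.ofMapLEIff (Subgroup.map ι) fun a b => Subgroup.map_le_map_iff_of_injective hι)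
    X (fun Y V _ hV => ⟨V.comap ι, ?_⟩) Y
  exact Subgroup.map_comap_eq_self (le_trans hV (Subgroup.map_le_range _ _))

theorem subgroupMoebius_comap {H : Type v} [Group H] [Finite H] {π : G →* H}
    (hπ : Function.Surjective π) (Y X : Subgroup H) :
    subgroupMoebius (Y.comap π) (X.comap π) = subgroupMoebius Y X := by
  refine subgroupMoebius_orderEmbedding
    (OrderEmbedding.ofMapLEIff (Subgroup.comap π) fun a b =>
      Subgroup.comap_le_comap_of_surjective hπ)
    X (fun Y V hV _ => ⟨V.map π, ?_⟩) Y
  refine Subgroup.comap_map_eq_self (le_trans ?_ hV)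
  exact Subgroup.ker_le_comap _ _

end Moebius

/-! ### Marks -/

section Marks

/-- The number of fixed points of a subgroup on a finite `G`-set. -/
noncomputable def fixedCard {G : Type u} [Group G] (Y : Subgroup G) (S : FinGSet G) : ℕ :=
  Nat.card {s : S.carrier // ∀ y ∈ Y, y • s = s}

theorem fixedCard_iso {G : Type u} [Group G] (Y : Subgroup G) {S T : FinGSet G} (h : S.Iso T) :
    fixedCard Y S = fixedCard Y T := by
  obtain ⟨f, hf⟩ := h
  refine Nat.card_congr (f.subtypeEquiv fun s => ?_)
  simp [← hf]

theorem fixedCard_disjUnion {G : Type u} [Group G] (Y : Subgroup G) (S T : FinGSet G) :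
    fixedCard Y (S.disjUnion T) = fixedCard Y S + fixedCard Y T := by
  rw [fixedCard, fixedCard, fixedCard, ← Nat.card_sum]
  refine Nat.card_congr ((Equiv.subtypeSum (p := fun s : S.carrier ⊕ T.carrier =>
    ∀ y ∈ Y, y • s = s)).trans (Equiv.sumCongr ?_ ?_))
  · exact Equiv.subtypeEquivRight fun s => by simp
  · exact Equiv.subtypeEquivRight fun s => by simp

/-- The mark homomorphism `[S] ↦ |S^Y|`. -/
noncomputable def mark (F : Type v) [Field F] {G : Type u} [Group G] (Y : Subgroup G) :
    FB F G →ₗ[F] F :=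
  FB.lift (fun S => (fixedCard Y S : F)) (fun _ _ h => by rw [fixedCard_iso Y h])
    (fun S T => by rw [fixedCard_disjUnion, Nat.cast_add])

variable {F : Type v} [Field F] {G : Type u} [Group G]

@[simp]
theorem mark_cls (Y : Subgroup G) (S : FinGSet G) : mark F Y (cls F S) = fixedCard Y S :=
  FB.lift_cls ..

theorem mark_map_conj (Y : Subgroup G) (g : G) (α : FB F G) :
    mark F (Y.map (MulAut.conj g).toMonoidHom) α = mark F Y α := by
  have h : mark F (Y.map (MulAut.conj g).toMonoidHom) = mark F Y := by
    refine FB.hom_ext fun S => ?_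
    rw [mark_cls, mark_cls]
    refine congrArg Nat.cast (Nat.card_congr
      ((MulAction.toPerm g⁻¹).subtypeEquiv fun s => ?_))
    constructor
    · intro h y hy
      have := h _ (Subgroup.mem_map_of_mem _ hy)
      simp only [MulEquiv.toMonoidHom_eq_coe, MonoidHom.coe_coe, MulAut.conj_apply] at this
      rw [MulAction.toPerm_apply, eq_inv_smul_iff, smul_smul, smul_smul, this]
    · rintro h _ ⟨y, hy, rfl⟩
      have := h y hy
      rw [MulAction.toPerm_apply, eq_inv_smul_iff, smul_smul, smul_smul] at this
      simpa using this
  rw [h]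

/-- Counting the orbits with a given property, weighted by the order of the group. -/
theorem card_mul_card_orbits {B U Q : Type*} [Group B] [Fintype U] [MulAction B U]
    (π : U → Q) (hπ : Function.Surjective π)
    (hfib : ∀ u u', π u = π u' ↔ u' ∈ MulAction.orbit B u) (P : Q → Prop) [DecidablePred P] :
    Nat.card B * Nat.card {q // P q} =
      ∑ u, if P (π u) then Nat.card (MulAction.stabilizer B u) else 0 := by
  classical
  have : Finite Q := Finite.of_surjective π hπ
  have : Fintype Q := Fintype.ofFinite Q
  rw [← Finset.sum_fiberwise Finset.univ π, Nat.card_eq_fintype_card (α := {q // P q}), Fintype.card_subtype,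
    mul_comm, Finset.card_eq_sum_ones, Finset.sum_filter, Finset.sum_mul]
  refine Finset.sum_congr rfl fun q _ => ?_
  have h : ∑ u with π u = q, (if P (π u) then Nat.card (MulAction.stabilizer B u) else 0) =
      if P q then ∑ u with π u = q, Nat.card (MulAction.stabilizer B u) else 0 := by
    split_ifs with hq
    · exact Finset.sum_congr rfl fun u hu => by simp [(Finset.mem_filter.1 hu).2, hq]
    · exact Finset.sum_eq_zero fun u hu => by simp [(Finset.mem_filter.1 hu).2, hq]
  rw [h]
  split_ifs with hq
  swap
  · simp
  obtain ⟨u₀, rfl⟩ := hπ q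
  have horb : (↑(Finset.univ.filter fun u => π u = π u₀) : Set U) = MulAction.orbit B u₀ := by
    ext u
    rw [Finset.mem_coe, Finset.mem_filter, eq_comm (a := π u), hfib]
    simp
  rw [Finset.sum_congr rfl (g := fun _ => Nat.card (MulAction.stabilizer B u₀)),
    Finset.sum_const, smul_eq_mul, one_mul, ← Set.ncard_coe_finset, horb,
    ← Nat.card_coe_set_eq, ← Nat.card_prod]
  · exact (Nat.card_congr (MulAction.orbitProdStabilizerEquivGroup B u₀)).symm
  · intro u hu
    have hu : u ∈ MulAction.orbit B u₀ := by rw [← horb]; simpa using hu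
    obtain ⟨b, rfl⟩ := hu
    exact (Nat.card_congr (MulAction.stabilizerEquivStabilizerOfOrbitRel ⟨b, rfl⟩).toEquiv)

open Classical in
theorem card_mul_fixedCard_cosetSet [Finite G] [Fintype G] (Z Y : Subgroup G) :
    Nat.card Y * fixedCard Z (cosetSet Y) =
      ∑ g : G, if Z.map (MulAut.conj g).toMonoidHom ≤ Y then 1 else 0 := by
  have h := card_mul_card_orbits (B := Y.op) (U := G) (Q := G ⧸ Y) QuotientGroup.mk
    QuotientGroup.mk_surjective (fun u u' => by
      rw [QuotientGroup.eq]
      constructor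
      · intro h
        exact ⟨⟨MulOpposite.op (u⁻¹ * u'), h⟩, by simp [Subgroup.smul_def]⟩
      · rintro ⟨b, rfl⟩
        have hb : MulOpposite.unop (b : Gᵐᵒᵖ) ∈ Y := b.2
        simpa [Subgroup.smul_def] using hb)
    (fun q => ∀ z ∈ Z, z • q = q)
  rw [Nat.card_congr Y.equivOp.symm] at h
  refine h.trans ?_
  -- `Z` fixes the coset `g⁻¹Y` exactly when `gZg⁻¹ ≤ Y`, hence the reindexing by inversion.
  rw [← Equiv.sum_comp (Equiv.inv G)]
  refine Finset.sum_congr rfl fun g _ => ?_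
  refine if_congr ?_ ?_ rfl
  · rw [Subgroup.map_le_iff_le_comap]
    refine forall₂_congr fun z _ => ?_
    change ((z * g⁻¹ : G) : G ⧸ Y) = (g⁻¹ : G) ↔ _
    rw [eq_comm, QuotientGroup.eq]
    simp [mul_assoc]
  · rw [Nat.card_eq_one_iff_unique]
    refine ⟨⟨fun a b => ?_⟩, ⟨1⟩⟩
    have key : ∀ c : MulAction.stabilizer Y.op (Equiv.inv G g), c = 1 := by
      rintro ⟨⟨c, hc⟩, h⟩
      have : g⁻¹ * c.unop = g⁻¹ := h
      have : c.unop = 1 := by simpa using this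
      ext
      simpa using this
    rw [key a, key b]

/-- Conjugation of subgroups. -/
def IsConjSubgroup (X Y : Subgroup G) : Prop :=
  ∃ g : G, X = Y.map (MulAut.conj g).toMonoidHom

theorem map_conj_map_conj (g h : G) (X : Subgroup G) :
    (X.map (MulAut.conj h).toMonoidHom).map (MulAut.conj g).toMonoidHom =
      X.map (MulAut.conj (g * h)).toMonoidHom := by
  rw [Subgroup.map_map]
  congr 1
  ext x
  simp

theorem map_conj_one (X : Subgroup G) : X.map (MulAut.conj (1 : G)).toMonoidHom = X := by
  convert X.map_id
  ext x
  simp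

theorem isConjSubgroup_refl (X : Subgroup G) : IsConjSubgroup X X :=
  ⟨1, (map_conj_one X).symm⟩

theorem IsConjSubgroup.symm {X Y : Subgroup G} (h : IsConjSubgroup X Y) : IsConjSubgroup Y X := by
  obtain ⟨g, rfl⟩ := h
  exact ⟨g⁻¹, by rw [map_conj_map_conj, inv_mul_cancel, map_conj_one]⟩

theorem IsConjSubgroup.trans {X Y Z : Subgroup G} (h : IsConjSubgroup X Y)
    (h' : IsConjSubgroup Y Z) : IsConjSubgroup X Z := by
  obtain ⟨g, rfl⟩ := h
  obtain ⟨g', rfl⟩ := h'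
  exact ⟨g * g', by rw [map_conj_map_conj]⟩

theorem IsConjSubgroup.card_eq {X Y : Subgroup G} (h : IsConjSubgroup X Y) :
    Nat.card X = Nat.card Y := by
  obtain ⟨g, rfl⟩ := h
  exact Subgroup.card_map_of_injective (MulAut.conj g).injective

theorem IsConjSubgroup.mark_eq {X Y : Subgroup G} (h : IsConjSubgroup X Y) (α : FB F G) :
    mark F X α = mark F Y α := by
  obtain ⟨g, rfl⟩ := h
  exact mark_map_conj ..

theorem IsConjSubgroup.cls_cosetSet_eq [Finite G] {X Y : Subgroup G} (h : IsConjSubgroup X Y) :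
    cls F (cosetSet X) = cls F (cosetSet Y) := by
  obtain ⟨g, rfl⟩ := h
  refine cls_iso ⟨⟨Quotient.map' (fun x => x * g) ?_, Quotient.map' (fun x => x * g⁻¹) ?_, ?_, ?_⟩,
    ?_⟩
  · intro a b h
    rw [QuotientGroup.leftRel_apply] at h ⊢
    obtain ⟨y, hy, h⟩ := h
    have : (a * g)⁻¹ * (b * g) = y := by
      have : g * y * g⁻¹ = a⁻¹ * b := h
      rw [mul_inv_rev, mul_assoc, ← mul_assoc a⁻¹, ← this]
      group
    rwa [this]
  · intro a b h
    rw [QuotientGroup.leftRel_apply] at h ⊢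
    refine ⟨_, h, ?_⟩
    change g * (a⁻¹ * b) * g⁻¹ = _
    group
  · rintro ⟨a⟩
    exact congrArg Quotient.mk'' (mul_inv_cancel_right a g)
  · rintro ⟨a⟩
    exact congrArg Quotient.mk'' (inv_mul_cancel_right a g)
  · rintro x ⟨a⟩
    exact congrArg Quotient.mk'' (mul_assoc x a g)

/-! ### Marks of the idempotents -/

theorem idem_eq_sum [Finite G] [Fintype (Subgroup G)] (X : Subgroup G) :
    idem F X = (Nat.card (Subgroup.normalizer (X : Set G)) : F)⁻¹ •
      ∑ Y : Subgroup G, ((Nat.card Y : F) * (subgroupMoebius Y X : F)) • cls F (cosetSet Y) := by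
  classical
  rw [idem, finsum_eq_sum_of_fintype]
  congr 1
  refine Finset.sum_congr rfl fun Y _ => ?_
  rw [finsum_eq_if]
  split_ifs with h
  · rfl
  · simp [subgroupMoebius_of_not_le h]

-- Once the sums are exchanged, Möbius inversion leaves the number of `g` with `gZg⁻¹ = X`. This set
-- is empty or a coset of the normalizer of `X`, whose order is the denominator.
open Classical in
theorem mark_idem [CharZero F] [Finite G] (X Z : Subgroup G) :
    mark F Z (idem F X) = if IsConjSubgroup X Z then 1 else 0 := by
  have : Fintype G := Fintype.ofFinite G
  let : Fintype (Subgroup G) := Fintype.ofFinite _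
  rw [idem_eq_sum, map_smul, map_sum]
  have h : ∀ Y : Subgroup G,
      mark F Z (((Nat.card Y : F) * (subgroupMoebius Y X : F)) • cls F (cosetSet Y)) =
      ∑ g : G, if Z.map (MulAut.conj g).toMonoidHom ≤ Y then (subgroupMoebius Y X : F) else 0 := by
    intro Y
    rw [map_smul, mark_cls, smul_eq_mul, mul_right_comm, ← Nat.cast_mul,
      card_mul_fixedCard_cosetSet, Nat.cast_sum, Finset.sum_mul]
    exact Finset.sum_congr rfl fun g _ => by split_ifs <;> simp
  simp_rw [h]
  rw [Finset.sum_comm]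
  have h2 : ∀ g : G, ∑ Y : Subgroup G,
      (if Z.map (MulAut.conj g).toMonoidHom ≤ Y then (subgroupMoebius Y X : F) else 0) =
      if X = Z.map (MulAut.conj g).toMonoidHom then 1 else 0 := by
    intro g
    have := congrArg (Int.cast : ℤ → F)
      (sum_subgroupMoebius_left (Z.map (MulAut.conj g).toMonoidHom) X)
    rw [Int.cast_sum] at this
    simp only [apply_ite (Int.cast : ℤ → F), Int.cast_zero, Int.cast_one] at this
    rw [this]
    exact if_congr eq_comm rfl rfl
  simp_rw [h2]
  rw [Finset.sum_boole]
  split_ifs with hX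
  · obtain ⟨g, rfl⟩ := hX
    have hcard : (Finset.univ.filter fun a => Z.map (MulAut.conj g).toMonoidHom =
        Z.map (MulAut.conj a).toMonoidHom).card =
        Nat.card (Subgroup.normalizer (Z.map (MulAut.conj g).toMonoidHom : Set G)) := by
      rw [← Fintype.card_subtype, ← Nat.card_eq_fintype_card]
      refine Nat.card_congr ((Equiv.mulRight g⁻¹).subtypeEquiv fun a => ?_)
      rw [Subgroup.mem_normalizer_iff_map_conj_eq]
      change _ ↔ (Z.map (MulAut.conj g).toMonoidHom).map (MulAut.conj (a * g⁻¹)).toMonoidHom = _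
      rw [map_conj_map_conj, inv_mul_cancel_right, eq_comm]
    rw [hcard, smul_eq_mul, inv_mul_cancel₀]
    exact_mod_cast Nat.card_pos.ne'
  · rw [Finset.filter_false_of_mem]
    · simp
    · exact fun g _ hg => hX ⟨g, hg⟩

/-! ### Transitive sets and idempotents span the Burnside algebra -/

theorem cls_eq_zero_of_isEmpty (S : FinGSet G) [IsEmpty S.carrier] : cls F S = 0 := by
  have h : cls F (S.disjUnion S) = cls F S :=
    cls_iso ⟨Equiv.sumEmpty S.carrier S.carrier, by rintro g (s | s) <;> exact isEmptyElim s⟩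
  rw [cls_disjUnion] at h
  simpa using h

theorem cls_mem_span_cosetSet [Finite G] (S : FinGSet G) :
    cls F S ∈ Submodule.span F (Set.range fun X : Subgroup G => cls F (cosetSet X)) := by
  induction h : Nat.card S.carrier using Nat.strong_induction_on generalizing S with
  | _ n ih =>
    rcases isEmpty_or_nonempty S.carrier with hS | ⟨⟨s⟩⟩
    · rw [cls_eq_zero_of_isEmpty S]
      exact zero_mem _
    let C : SubMulAction G S.carrier :=
      { carrier := (MulAction.orbit G s)ᶜ
        smul_mem' := fun g x hx hgx => hx (by
          simpa using MulAction.mem_orbit_of_mem_orbit g⁻¹ hgx) }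
    let T : FinGSet G := { carrier := C }
    have hiso : ((cosetSet (MulAction.stabilizer G s)).disjUnion T).Iso S := by
      refine ⟨Equiv.ofBijective (Sum.elim (MulAction.ofQuotientStabilizer G s)
        (fun x : C => (x : S.carrier))) ⟨?_, ?_⟩, ?_⟩
      · refine Function.Injective.sumElim (MulAction.injective_ofQuotientStabilizer G s)
          Subtype.val_injective ?_
        rintro ⟨a⟩ b hab
        exact b.2 ⟨a, hab⟩
      · intro x
        by_cases hx : x ∈ MulAction.orbit G s
        · obtain ⟨g, rfl⟩ := hx
          exact ⟨Sum.inl (g : G ⧸ MulAction.stabilizer G s), rfl⟩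
        · exact ⟨Sum.inr ⟨x, hx⟩, rfl⟩
      · rintro g (x | x)
        · exact MulAction.ofQuotientStabilizer_smul G s g x
        · rfl
    rw [← cls_iso hiso, cls_disjUnion]
    refine add_mem (Submodule.subset_span ⟨_, rfl⟩) (ih _ ?_ T rfl)
    rw [← h]
    exact Finite.card_subtype_lt (p := fun x => x ∈ C) (x := s)
      (fun hs => hs (MulAction.mem_orbit_self s))

theorem span_cosetSet [Finite G] :
    Submodule.span F (Set.range fun X : Subgroup G => cls F (cosetSet X)) = ⊤ := by
  rw [eq_top_iff]
  rintro x -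
  obtain ⟨x, rfl⟩ := (burnsideRelations F G).mkQ_surjective x
  induction x using Finsupp.induction_linear with
  | zero => simp
  | add x y hx hy => rw [map_add]; exact add_mem hx hy
  | single S c =>
    rw [← mul_one c, ← smul_eq_mul, ← Finsupp.smul_single, map_smul]
    exact Submodule.smul_mem _ _ (cls_mem_span_cosetSet S)

theorem isConjReps_unique {P : Subgroup G → Prop} {R : Set (Subgroup G)} (hR : IsConjReps P R)
    {X Y : Subgroup G} (hX : X ∈ R) (hY : Y ∈ R) (h : IsConjSubgroup X Y) : X = Y :=
  (hR.2 Y (hR.1 Y hY)).unique ⟨hX, h⟩ ⟨hY, isConjSubgroup_refl Y⟩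

variable (G) in
theorem exists_isConjReps : ∃ R : Set (Subgroup G), IsConjReps (fun _ => True) R := by
  let s : Setoid (Subgroup G) :=
    ⟨IsConjSubgroup, isConjSubgroup_refl, IsConjSubgroup.symm, IsConjSubgroup.trans⟩
  refine ⟨Set.range (Quotient.out (s := s)), fun _ _ => trivial, fun Y _ =>
    ⟨(Quotient.mk s Y).out, ⟨⟨_, rfl⟩, Quotient.mk_out (s := s) Y⟩, ?_⟩⟩
  rintro _ ⟨⟨q, rfl⟩, h⟩
  have h : s q.out Y := h
  rw [← Quotient.sound h, Quotient.out_eq]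

/-- Triangularity: `e_Y` is a nonzero multiple of `[G/Y]` plus a combination of the `[G/Z]` with `Z
< Y`, so induction on the order recovers every transitive class. -/
theorem span_idem [CharZero F] [Finite G] {R : Set (Subgroup G)}
    (hR : IsConjReps (fun _ => True) R) :
    Submodule.span F (Set.range fun X : R => idem F (X : Subgroup G)) = ⊤ := by
  rw [eq_top_iff, ← span_cosetSet, Submodule.span_le]
  rintro _ ⟨X, rfl⟩
  classical
  simp only [SetLike.mem_coe]
  let : Fintype (Subgroup G) := Fintype.ofFinite _
  induction h : Nat.card X using Nat.strong_induction_on generalizing X with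
  | _ n ih =>
    obtain ⟨Y, ⟨hYR, hYX⟩, -⟩ := hR.2 X trivial
    have hYX : IsConjSubgroup Y X := hYX
    rw [← hYX.cls_cosetSet_eq]
    have hN : (Nat.card (Subgroup.normalizer (Y : Set G)) : F) ≠ 0 :=
      Nat.cast_ne_zero.2 Nat.card_pos.ne'
    have hcY : (Nat.card Y : F) ≠ 0 := Nat.cast_ne_zero.2 Nat.card_pos.ne'
    have h1 := idem_eq_sum (F := F) Y
    rw [eq_inv_smul_iff₀ hN, ← Finset.add_sum_erase _ _ (Finset.mem_univ Y),
      subgroupMoebius_self, Int.cast_one, mul_one, ← sub_eq_iff_eq_add, ← inv_smul_eq_iff₀ hcY] at h1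
    rw [← h1]
    refine Submodule.smul_mem _ _ (sub_mem (Submodule.smul_mem _ _
      (Submodule.subset_span ⟨⟨Y, hYR⟩, rfl⟩)) (sum_mem fun Z hZ => ?_))
    by_cases hZY : Z ≤ Y
    · refine Submodule.smul_mem _ _ (ih _ ?_ Z rfl)
      rw [← h, ← hYX.card_eq]
      have hlt : Z < Y := lt_of_le_of_ne hZY (Finset.ne_of_mem_erase hZ)
      exact Set.ncard_lt_ncard (SetLike.coe_ssubset_coe.2 hlt) (Set.toFinite _)
    · simp [subgroupMoebius_of_not_le hZY]

theorem eq_sum_mark_smul_idem [CharZero F] [Finite G] {R : Set (Subgroup G)} [Fintype R]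
    (hR : IsConjReps (fun _ => True) R) (α : FB F G) :
    α = ∑ X : R, mark F (X : Subgroup G) α • idem F (X : Subgroup G) := by
  classical
  have h : LinearMap.id = ∑ X : R, (mark F (X : Subgroup G)).smulRight (idem F (X : Subgroup G)) := by
    refine LinearMap.ext_on_range (span_idem hR) fun Y => ?_
    rw [LinearMap.id_apply, LinearMap.sum_apply, Finset.sum_eq_single Y _ (by simp)]
    · rw [LinearMap.smulRight_apply, mark_idem, if_pos (isConjSubgroup_refl _), one_smul]
    · intro X _ hXY
      rw [LinearMap.smulRight_apply, mark_idem, if_neg, zero_smul]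
      exact fun h => hXY (Subtype.ext (isConjReps_unique hR Y.2 X.2 h)).symm
  simpa using LinearMap.congr_fun h α

theorem mark_ext [CharZero F] [Finite G] {α β : FB F G}
    (h : ∀ X : Subgroup G, mark F X α = mark F X β) : α = β := by
  obtain ⟨R, hR⟩ := exists_isConjReps G
  have : Fintype R := Fintype.ofFinite R
  rw [eq_sum_mark_smul_idem hR α, eq_sum_mark_smul_idem hR β]
  simp_rw [h]

/-- A linear form which does not vanish on an element does not vanish on one of its idempotent
components. -/
theorem exists_idem_of_ne_zero [CharZero F] [Finite G] {V : Type*} [AddCommGroup V] [Module F V]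
    (f : FB F G →ₗ[F] V) {α : FB F G} (h : f α ≠ 0) :
    ∃ X : Subgroup G, mark F X α ≠ 0 ∧ f (idem F X) ≠ 0 := by
  obtain ⟨R, hR⟩ := exists_isConjReps G
  have : Fintype R := Fintype.ofFinite R
  rw [eq_sum_mark_smul_idem hR α, map_sum] at h
  obtain ⟨X, -, hX⟩ := Finset.exists_ne_zero_of_sum_ne_zero h
  rw [map_smul] at hX
  exact ⟨X, left_ne_zero_of_smul hX, right_ne_zero_of_smul hX⟩

end Marks

/-! ### The numbers `m_{L,N}` -/

section MNumber

/-- Moves a sum below a subgroup to the whole group `A`, where the numbers `m_{A,N}` are defined;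
subgroups not below the range have Möbius value 0. -/
theorem sum_subgroupMoebius_range {A G R : Type*} [Group A] [Finite A] [Group G] [Finite G]
    [Fintype (Subgroup A)] [Fintype (Subgroup G)] [Ring R] {ι : A →* G}
    (hι : Function.Injective ι) (h : Subgroup G → R) :
    ∑ Y : Subgroup G, (subgroupMoebius Y ι.range : R) * h Y =
      ∑ B : Subgroup A, (subgroupMoebius B ⊤ : R) * h (B.map ι) := by
  classical
  have h1 : ∀ B : Subgroup A, subgroupMoebius B ⊤ = subgroupMoebius (B.map ι) ι.range := by
    intro B
    rw [← subgroupMoebius_map hι, ← MonoidHom.range_eq_map]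
  simp_rw [h1]
  rw [← Finset.sum_image (g := fun B : Subgroup A => B.map ι)
    (f := fun Y : Subgroup G => (subgroupMoebius Y ι.range : R) * h Y)
    (fun B _ B' _ hB => Subgroup.map_injective hι hB)]
  symm
  refine Finset.sum_subset (Finset.subset_univ _) fun Y _ hY => ?_
  rw [subgroupMoebius_of_not_le, Int.cast_zero, zero_mul]
  intro hle
  exact hY (Finset.mem_image.2 ⟨Y.comap ι, Finset.mem_univ _, Subgroup.map_comap_eq_self hle⟩)

open Classical in
theorem card_mul_mNumber {A : Type*} [Group A] [Finite A] [Fintype (Subgroup A)] (N : Subgroup A) :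
    (Nat.card A : ℚ) * mNumber N =
      ∑ B : Subgroup A, (subgroupMoebius B ⊤ : ℚ) * if B ⊔ N = ⊤ then (Nat.card B : ℚ) else 0 := by
  rw [mNumber, mul_inv_cancel_left₀ (Nat.cast_ne_zero.2 Nat.card_pos.ne'),
    finsum_eq_sum_of_fintype]
  refine Finset.sum_congr rfl fun B _ => ?_
  rw [finsum_eq_if]
  split_ifs <;> ring

theorem mNumber_bot {A : Type*} [Group A] [Finite A] : mNumber (⊥ : Subgroup A) = 1 := by
  classical
  let : Fintype (Subgroup A) := Fintype.ofFinite _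
  have h := card_mul_mNumber (⊥ : Subgroup A)
  rw [Finset.sum_eq_single ⊤ (by simp +contextual) (by simp)] at h
  have hA : (Nat.card A : ℚ) ≠ 0 := Nat.cast_ne_zero.2 Nat.card_pos.ne'
  simpa [hA] using h

theorem card_mul_card_of_sup_eq_top {A : Type*} [Group A] [Finite A] (B N : Subgroup A)
    [N.Normal] (h : B ⊔ N = ⊤) :
    Nat.card B * Nat.card N = Nat.card A * Nat.card (B ⊓ N : Subgroup A) := by
  have h1 : N.relIndex B = N.index := by
    rw [← Subgroup.relIndex_sup_left, sup_comm, h, Subgroup.relIndex_top_right]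
  rw [← Subgroup.card_mul_index N, ← h1, inf_comm,
    ← Subgroup.card_mul_index (N.subgroupOf B), Subgroup.relIndex,
    ← Nat.card_congr (Subgroup.subgroupOfEquivOfLe (inf_le_right : N ⊓ B ≤ B)).toEquiv,
    Subgroup.inf_subgroupOf_right]
  ring

end MNumber

/-! ### The action of bisets on idempotents -/

namespace Biset

variable {F : Type v} [Field F] {H G : Type u} [Group H] [Group G]

/-- The stabilizer of a point of a biset for the right action. -/
def rightStab (W : Biset H G) (w : W.carrier) : Subgroup G :=
  (MulAction.stabilizer Gᵐᵒᵖ w).unop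

theorem mem_rightStab {W : Biset H G} {w : W.carrier} {g : G} :
    g ∈ W.rightStab w ↔ MulOpposite.op g • w = w := Iff.rfl

/-- The elements `g` with `w g ∈ Z w`. -/
def transporter (W : Biset H G) (Z : Subgroup H) (w : W.carrier) : Subgroup G where
  carrier := {g | ∃ z ∈ Z, z • w = MulOpposite.op g • w}
  one_mem' := ⟨1, one_mem _, by simp⟩
  mul_mem' := by
    rintro a b ⟨z, hz, h⟩ ⟨z', hz', h'⟩
    refine ⟨z * z', mul_mem hz hz', ?_⟩
    rw [mul_smul, h', smul_comm, h, smul_smul, MulOpposite.op_mul]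
  inv_mem' := by
    rintro a ⟨z, hz, h⟩
    refine ⟨z⁻¹, inv_mem hz, ?_⟩
    rw [inv_smul_eq_iff, smul_comm, h, smul_smul]
    simp

theorem rightStab_le_transporter (W : Biset H G) (Z : Subgroup H) (w : W.carrier) :
    W.rightStab w ≤ W.transporter Z w := fun g hg =>
  ⟨1, one_mem _, by rw [one_smul, mem_rightStab.1 hg]⟩

theorem conj_mem_rightStab {W : Biset H G} {Z : Subgroup H} {w : W.carrier} {g s : G}
    (hg : g ∈ W.transporter Z w) (hs : s ∈ W.rightStab w) : g * s * g⁻¹ ∈ W.rightStab w := by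
  obtain ⟨z, -, h⟩ := hg
  rw [mem_rightStab] at hs ⊢
  rw [MulOpposite.op_mul, MulOpposite.op_mul, mul_smul, mul_smul, ← h, ← smul_comm z, hs, h,
    smul_smul, ← MulOpposite.op_mul]
  simp

/-- `Z w ⊆ w Y`. -/
def Covers (W : Biset H G) (Z : Subgroup H) (w : W.carrier) (Y : Subgroup G) : Prop :=
  ∀ z ∈ Z, ∃ y ∈ Y, z • w = MulOpposite.op y • w

theorem covers_inf_transporter {W : Biset H G} {Z : Subgroup H} {w : W.carrier} {Y : Subgroup G} :
    W.Covers Z w (Y ⊓ W.transporter Z w) ↔ W.Covers Z w Y :=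
  forall₂_congr fun z hz => exists_congr fun _ =>
    ⟨fun h => ⟨h.1.1, h.2⟩, fun h => ⟨⟨h.1, z, hz, h.2⟩, h.2⟩⟩

theorem Covers.mono {W : Biset H G} {Z : Subgroup H} {w : W.carrier} {Y Y' : Subgroup G}
    (h : W.Covers Z w Y) (hY : Y ≤ Y') : W.Covers Z w Y' := fun z hz =>
  let ⟨y, hy, e⟩ := h z hz
  ⟨y, hY hy, e⟩

-- The set `W ×_G (G/Y)` is the orbit set `W/Y`, every class having a representative with second
-- component the trivial coset. The class of `w` is fixed by `Z` exactly when `Zw ⊆ wY`, and its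
-- stabilizer in `Y` supplies the weight.
open Classical in
theorem card_mul_fixedCard_tensor [Finite G] (W : Biset H G) [Fintype W.carrier] (Z : Subgroup H)
    (Y : Subgroup G) :
    Nat.card Y * fixedCard Z (W.tensor (cosetSet Y)) =
      ∑ w : W.carrier, if W.Covers Z w Y then Nat.card (Y ⊓ W.rightStab w : Subgroup G) else 0 := by
  have hrel : ∀ w w' : W.carrier, (Quotient.mk (W.tensorSetoid (cosetSet Y)) (w, ((1 : G) : G ⧸ Y)) =
      Quotient.mk (W.tensorSetoid (cosetSet Y)) (w', ((1 : G) : G ⧸ Y))) ↔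
      ∃ y ∈ Y, w' = MulOpposite.op y • w := by
    intro w w'
    rw [Quotient.eq]
    refine exists_congr fun g => ?_
    have : (((1 : G) : G ⧸ Y) = g⁻¹ • ((1 : G) : G ⧸ Y)) ↔ g ∈ Y := by
      change ((1 : G) : G ⧸ Y) = ((g⁻¹ * 1 : G) : G ⧸ Y) ↔ _
      rw [QuotientGroup.eq]
      simp
    rw [← this, and_comm]
    exact Prod.mk.injEq .. ▸ Iff.rfl
  have h := card_mul_card_orbits (B := Y.op)
    (fun w : W.carrier => Quotient.mk (W.tensorSetoid (cosetSet Y)) (w, ((1 : G) : G ⧸ Y)))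
    (by
      rintro ⟨w, ⟨g⟩⟩
      refine ⟨MulOpposite.op g • w, Quotient.sound ⟨g⁻¹, Prod.ext ?_ ?_⟩⟩
      · simp [smul_smul]
      · exact congrArg Quotient.mk'' (by simp))
    (fun w w' => by
      rw [hrel]
      constructor
      · rintro ⟨y, hy, rfl⟩
        exact ⟨⟨MulOpposite.op y, hy⟩, rfl⟩
      · rintro ⟨⟨b, hb⟩, rfl⟩
        exact ⟨b.unop, hb, rfl⟩)
    (fun q : (W.tensor (cosetSet Y)).carrier => ∀ z ∈ Z, z • q = q)
  rw [Nat.card_congr Y.equivOp.symm] at h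
  refine h.trans (Finset.sum_congr rfl fun w _ => if_congr ?_ ?_ rfl)
  · refine forall₂_congr fun z _ => ?_
    exact Iff.trans eq_comm (hrel w (z • w))
  · refine Nat.card_congr ⟨fun b => ⟨(b : Y.op).1.unop, (b : Y.op).2, b.2⟩,
      fun y => ⟨⟨MulOpposite.op y.1, y.2.1⟩, y.2.2⟩, fun _ => rfl, fun _ => rfl⟩

/-- The hypotheses give `Zw = wA`. The stabilizer `N` of `w` in `A` is normal, so `wA` is a copy of
`A/N`, and `wB` is all of it exactly when `B` maps onto `A/N`. -/
theorem covers_map_iff {A : Type w} [Group A] {ι : A →* G} {W : Biset H G} {Z : Subgroup H}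
    {w : W.carrier} (hT : ι.range ≤ W.transporter Z w) (hC : W.Covers Z w ι.range)
    (B : Subgroup A) :
    W.Covers Z w (B.map ι) ↔ B ⊔ (W.rightStab w).comap ι = ⊤ := by
  constructor
  · intro h
    rw [eq_top_iff]
    rintro a -
    obtain ⟨z, hz, ha⟩ := hT ⟨a, rfl⟩
    obtain ⟨_, ⟨b, hb, rfl⟩, hzb⟩ := h z hz
    have hs : a * b⁻¹ ∈ (W.rightStab w).comap ι := by
      rw [Subgroup.mem_comap, mem_rightStab, map_mul, MulOpposite.op_mul, mul_smul, ← ha, hzb,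
        smul_smul, ← MulOpposite.op_mul]
      simp
    simpa using mul_mem (Subgroup.mem_sup_right (S := B) hs)
      (Subgroup.mem_sup_left (T := (W.rightStab w).comap ι) hb)
  · intro h z hz
    obtain ⟨_, ⟨a, rfl⟩, hza⟩ := hC z hz
    have hnorm : ((W.rightStab w).comap ι).Normal := by
      refine ⟨fun s hs g => ?_⟩
      simpa using conj_mem_rightStab (hT ⟨g, rfl⟩) (Subgroup.mem_comap.1 hs)
    have ha : a ∈ (W.rightStab w).comap ι ⊔ B := by rw [sup_comm, h]; trivial
    obtain ⟨s, hs, b, hb, rfl⟩ := Subgroup.mem_sup_of_normal_left.1 ha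
    refine ⟨ι b, ⟨b, hb, rfl⟩, ?_⟩
    rw [hza, map_mul, MulOpposite.op_mul, mul_smul, mem_rightStab.1 hs]

-- The contribution of `w` is a Möbius sum over `Y`. It vanishes unless `wA ⊆ Zw`, by Weisner's
-- theorem, and unless `Zw ⊆ wA`, because no subgroup of `A` then covers. In the remaining case it
-- is the sum of `|B ∩ N| μ(B, A)` over `BN = A`, which is `|N| m_{A,N}` because `|A||B ∩ N| =
-- |B||N|`.
open Classical in
theorem mark_map_idem [CharZero F] [Finite H] [Finite G] {A : Type w} [Group A] [Finite A]
    {ι : A →* G} (hι : Function.Injective ι) (W : Biset H G) [Fintype W.carrier]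
    (Z : Subgroup H) :
    mark F Z (W.map F (idem F ι.range)) =
      (Nat.card (Subgroup.normalizer (ι.range : Set G)) : F)⁻¹ *
        ∑ w : W.carrier, if ι.range ≤ W.transporter Z w ∧ W.Covers Z w ι.range then
          (((Nat.card ((W.rightStab w).comap ι) : ℚ) * mNumber ((W.rightStab w).comap ι) : ℚ) : F)
          else 0 := by
  let : Fintype (Subgroup G) := Fintype.ofFinite _
  let : Fintype (Subgroup A) := Fintype.ofFinite _
  rw [idem_eq_sum, map_smul, map_smul, smul_eq_mul, map_sum, map_sum]
  congr 1
  have h : ∀ Y : Subgroup G, mark F Z (W.map F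
      (((Nat.card Y : F) * (subgroupMoebius Y ι.range : F)) • cls F (cosetSet Y))) =
      ∑ w : W.carrier, (subgroupMoebius Y ι.range : F) *
        if W.Covers Z w Y then (Nat.card (Y ⊓ W.rightStab w : Subgroup G) : F) else 0 := by
    intro Y
    rw [map_smul, map_smul, Biset.map, FB.lift_cls, mark_cls, smul_eq_mul, mul_comm (Nat.card Y : F),
      mul_assoc, ← Nat.cast_mul, card_mul_fixedCard_tensor, ← Finset.mul_sum, Nat.cast_sum]
    congr 1
    exact Finset.sum_congr rfl fun w _ => by split_ifs <;> simp
  rw [Finset.sum_congr rfl fun Y _ => h Y, Finset.sum_comm]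
  refine Finset.sum_congr rfl fun w _ => ?_
  by_cases hT : ι.range ≤ W.transporter Z w
  swap
  · rw [if_neg fun h => hT h.1]
    -- The weight of `Y` depends only on its intersection with the transporter, which contains the
    -- stabilizer of `w`.
    refine Eq.trans ?_ (sum_subgroupMoebius_mul_inf_eq_zero (R := F) _ _ hT
      (fun Y => if W.Covers Z w Y then (Nat.card (Y ⊓ W.rightStab w : Subgroup G) : F) else 0))
    refine Finset.sum_congr rfl fun Y _ => ?_
    simp only [covers_inf_transporter]
    rw [inf_assoc, inf_eq_right.2 (W.rightStab_le_transporter Z w)]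
  by_cases hC : W.Covers Z w ι.range
  swap
  · rw [if_neg fun h => hC h.2]
    refine Finset.sum_eq_zero fun Y _ => ?_
    by_cases hY : Y ≤ ι.range
    · rw [if_neg fun h => hC (h.mono hY), mul_zero]
    · rw [subgroupMoebius_of_not_le hY, Int.cast_zero, zero_mul]
  rw [if_pos ⟨hT, hC⟩, sum_subgroupMoebius_range hι]
  set N := (W.rightStab w).comap ι with hN
  have hnorm : N.Normal := by
    refine ⟨fun s hs g => ?_⟩
    simpa [hN] using conj_mem_rightStab (hT ⟨g, rfl⟩) (Subgroup.mem_comap.1 hs)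
  have hA : (Nat.card A : F) ≠ 0 := Nat.cast_ne_zero.2 Nat.card_pos.ne'
  rw [← mul_right_inj' hA]
  have h2 := congrArg (fun q : ℚ => ((Nat.card N * q : ℚ) : F)) (card_mul_mNumber N)
  rw [mul_left_comm] at h2
  push_cast at h2 ⊢
  rw [h2, Finset.mul_sum, Finset.mul_sum]
  refine Finset.sum_congr rfl fun B _ => ?_
  rw [covers_map_iff hT hC, ← hN]
  split_ifs with hB
  · have h3 : Nat.card (B.map ι ⊓ W.rightStab w : Subgroup G) = Nat.card (B ⊓ N : Subgroup A) := by
      rw [← (Subgroup.card_map_of_injective hι : Nat.card ((B ⊓ N).map ι) = _), hN,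
        Subgroup.map_inf _ _ _ hι, Subgroup.map_comap_eq, ← inf_assoc,
        inf_of_le_left (Subgroup.map_le_range _ _)]
    have h4 := congrArg (Nat.cast : ℕ → F) (card_mul_card_of_sup_eq_top B N hB)
    push_cast at h4
    rw [h3]
    push_cast
    linear_combination (-(subgroupMoebius B ⊤ : F)) * h4
  · simp

end Biset

/-! ### Groups over `K` -/

section Over

variable {K : Type u} [Group K]

theorem IsOverHom.comp {L M N : Type u} [Group L] [Group M] [Group N] {φ : L →* K} {ψ : M →* K}
    {χ : N →* K} {g : M →* N} {f : L →* M} (hg : IsOverHom ψ χ g) (hf : IsOverHom φ ψ f) :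
    IsOverHom φ χ (g.comp f) := by
  obtain ⟨k, hk⟩ := hf
  obtain ⟨k', hk'⟩ := hg
  exact ⟨k' * k, fun l => by rw [map_mul, MulAut.mul_apply, hk, hk', MonoidHom.comp_apply]⟩

theorem OverQuotient.trans {L M N : Type u} [Group L] [Group M] [Group N] {φ : L →* K}
    {ψ : M →* K} {χ : N →* K} (h : OverQuotient φ ψ) (h' : OverQuotient ψ χ) :
    OverQuotient φ χ := by
  obtain ⟨f, hf, hf'⟩ := h
  obtain ⟨g, hg, hg'⟩ := h'
  exact ⟨g.comp f, hg.comp hf, hg'.comp hf'⟩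

theorem IsOverHom.map_ker {L M : Type u} [Group L] [Group M] {φ : L →* K} {ψ : M →* K}
    {f : L →* M} (h : IsOverHom φ ψ f) {l : L} : ψ (f l) = 1 ↔ φ l = 1 := by
  obtain ⟨k, hk⟩ := h
  rw [← hk l]
  simp

theorem OverIso.overQuotient {L M : Type u} [Group L] [Group M] {φ : L →* K} {ψ : M →* K}
    (h : OverIso φ ψ) : OverQuotient φ ψ := by
  obtain ⟨f, g, hf, -, -, hfg⟩ := h
  exact ⟨f, fun m => ⟨g m, DFunLike.congr_fun hfg m⟩, hf⟩

theorem OverIso.of_mulEquiv {L M : Type u} [Group L] [Group M] {φ : L →* K} {ψ : M →* K}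
    (e : L ≃* M) (h : IsOverHom φ ψ e.toMonoidHom) : OverIso φ ψ := by
  refine ⟨e.toMonoidHom, e.symm.toMonoidHom, h, ?_, by ext; simp, by ext; simp⟩
  obtain ⟨k, hk⟩ := h
  refine ⟨k⁻¹, fun m => ?_⟩
  have := hk (e.symm m)
  simp only [MulEquiv.toMonoidHom_eq_coe, MonoidHom.coe_coe, MulEquiv.apply_symm_apply] at this ⊢
  rw [← this, ← MulAut.mul_apply, ← map_mul, inv_mul_cancel, map_one, MulAut.one_apply]

theorem OverIso.symm {L M : Type u} [Group L] [Group M] {φ : L →* K} {ψ : M →* K}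
    (h : OverIso φ ψ) : OverIso ψ φ := by
  obtain ⟨f, g, hf, hg, h1, h2⟩ := h
  exact ⟨g, f, hg, hf, h2, h1⟩

theorem OverIso.card_eq {L M : Type u} [Group L] [Group M] {φ : L →* K} {ψ : M →* K}
    (h : OverIso φ ψ) : Nat.card L = Nat.card M := by
  obtain ⟨f, g, -, -, h1, h2⟩ := h
  exact Nat.card_congr ⟨f, g, DFunLike.congr_fun h1, DFunLike.congr_fun h2⟩

theorem OverIso.of_overQuotient {L M : Type u} [Group L] [Group M] [Finite M] {φ : L →* K}
    {ψ : M →* K} (h : OverQuotient φ ψ) (hcard : Nat.card L = Nat.card M) : OverIso φ ψ := by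
  obtain ⟨f, hf, hf'⟩ := h
  have : Finite L := Nat.finite_of_card_ne_zero (hcard ▸ Nat.card_pos.ne')
  have hbij : Function.Bijective f := (Nat.bijective_iff_surjective_and_card f).2 ⟨hf, hcard⟩
  exact OverIso.of_mulEquiv (MulEquiv.ofBijective f hbij) hf'

theorem OverQuotient.card_le {L M : Type u} [Group L] [Group M] [Finite L] {φ : L →* K}
    {ψ : M →* K} (h : OverQuotient φ ψ) : Nat.card M ≤ Nat.card L := by
  obtain ⟨f, hf, -⟩ := h
  exact Nat.card_le_card_of_surjective f hf

/-! ### Supplements and surjections onto a `B_K`-group -/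

theorem map_subtype_sup_eq_top_iff {M : Type u} [Group M] {X N : Subgroup M} [N.Normal]
    (h : X ⊔ N = ⊤) (B : Subgroup X) :
    B.map X.subtype ⊔ N = ⊤ ↔ B ⊔ N.subgroupOf X = ⊤ := by
  constructor
  · intro hB
    rw [eq_top_iff]
    rintro x -
    have hx : (x : M) ∈ B.map X.subtype ⊔ N := by rw [hB]; trivial
    obtain ⟨_, ⟨b, hb, rfl⟩, n, hn, hbn⟩ := Subgroup.mem_sup_of_normal_right.1 hx
    have hn' : b⁻¹ * x ∈ N.subgroupOf X := by
      rw [Subgroup.mem_subgroupOf]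
      simpa [← hbn] using hn
    simpa using mul_mem (Subgroup.mem_sup_left (T := N.subgroupOf X) hb)
      (Subgroup.mem_sup_right (S := B) hn')
  · intro hB
    rw [eq_top_iff, ← h]
    refine sup_le (fun x hx => ?_) le_sup_right
    have hx' : (⟨x, hx⟩ : X) ∈ B ⊔ N.subgroupOf X := by rw [hB]; trivial
    obtain ⟨b, hb, n, hn, hbn⟩ := Subgroup.mem_sup_of_normal_right.1 hx'
    have : x = (b : M) * n := (congrArg Subtype.val hbn).symm
    rw [this]
    exact mul_mem (Subgroup.mem_sup_left ⟨b, hb, rfl⟩) (Subgroup.mem_sup_right hn)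

-- When the sums are exchanged, `sum_subgroupMoebius_sup_eq_top` keeps only the `Z` containing `ker
-- f`. These are the preimages of the subgroups of `L`, with orders multiplied by `|ker f|`.
open Classical in
theorem sum_sup_ker_eq_top {M L : Type u} [Group M] [Finite M] [Group L] [Finite L]
    [Fintype (Subgroup M)] {f : M →* L} (hf : Function.Surjective f) (N : Subgroup M) :
    ∑ X : Subgroup M, (if X ⊔ f.ker = ⊤ then ∑ Z : Subgroup M, (subgroupMoebius Z X : ℚ) *
      (if Z ⊔ N = ⊤ then (Nat.card Z : ℚ) else 0) else 0) =
      Nat.card M * mNumber (N.map f) := by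
  let : Fintype (Subgroup L) := Fintype.ofFinite _
  have h1 : ∀ X : Subgroup M, (if X ⊔ f.ker = ⊤ then ∑ Z : Subgroup M,
      (subgroupMoebius Z X : ℚ) * (if Z ⊔ N = ⊤ then (Nat.card Z : ℚ) else 0) else 0) =
      ∑ Z : Subgroup M, ((if X ⊔ f.ker = ⊤ then subgroupMoebius Z X else 0 : ℤ) : ℚ) *
        (if Z ⊔ N = ⊤ then (Nat.card Z : ℚ) else 0) := by
    intro X
    split_ifs <;> simp
  simp_rw [h1]
  rw [Finset.sum_comm]
  simp_rw [← Finset.sum_mul, ← Int.cast_sum, sum_subgroupMoebius_sup_eq_top]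
  have hcard : Nat.card M = Nat.card f.ker * Nat.card L := by
    rw [← Subgroup.card_mul_index f.ker, Subgroup.index_ker, f.range_eq_top.2 hf,
      Subgroup.card_top]
  rw [hcard, Nat.cast_mul, mul_assoc, card_mul_mNumber, Finset.mul_sum]
  have hinj : Function.Injective (Subgroup.comap f) := Subgroup.comap_injective hf
  symm
  have h2 : ∀ V : Subgroup L, (Nat.card f.ker : ℚ) *
      ((subgroupMoebius V ⊤ : ℚ) * if V ⊔ N.map f = ⊤ then (Nat.card V : ℚ) else 0) =
      ((if f.ker ≤ V.comap f then subgroupMoebius (V.comap f) ⊤ else 0 : ℤ) : ℚ) *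
        (if V.comap f ⊔ N = ⊤ then (Nat.card (V.comap f) : ℚ) else 0) := by
    intro V
    rw [if_pos (Subgroup.ker_le_comap f V), ← Subgroup.comap_top f, subgroupMoebius_comap hf]
    have h3 : V.comap f ⊔ N = ⊤ ↔ V ⊔ N.map f = ⊤ := by
      constructor
      · intro h
        have := congrArg (Subgroup.map f) h
        rwa [Subgroup.map_sup, Subgroup.map_comap_eq_self_of_surjective hf,
          Subgroup.map_top_of_surjective f hf] at this
      · intro h
        have h4 := Subgroup.comap_map_eq_self
          ((Subgroup.ker_le_comap f V).trans (le_sup_left (b := N)))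
        rw [Subgroup.map_sup, Subgroup.map_comap_eq_self_of_surjective hf, h,
          Subgroup.comap_top] at h4
        exact h4.symm
    have h5 : Nat.card (V.comap f) = Nat.card f.ker * Nat.card V := by
      have h6 := Subgroup.card_mul_index (V.comap f)
      rw [Subgroup.index_comap_of_surjective V hf, hcard, ← Subgroup.card_mul_index V,
        ← mul_assoc] at h6
      exact Nat.eq_of_mul_eq_mul_right (Nat.pos_of_ne_zero V.index_ne_zero_of_finite) h6
    rw [Subgroup.comap_top, h5]
    simp only [h3]
    split_ifs <;> push_cast <;> ring
  simp_rw [h2]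
  rw [← Finset.sum_image (g := fun V : Subgroup L => V.comap f)
    (f := fun Z : Subgroup M => ((if f.ker ≤ Z then subgroupMoebius Z ⊤ else 0 : ℤ) : ℚ) *
      (if Z ⊔ N = ⊤ then (Nat.card Z : ℚ) else 0)) (fun V _ V' _ h => hinj h)]
  refine Finset.sum_subset (Finset.subset_univ _) fun Z _ hZ => ?_
  rw [if_neg, Int.cast_zero, zero_mul]
  exact fun hle => hZ (Finset.mem_image.2 ⟨Z.map f, Finset.mem_univ _,
    Subgroup.comap_map_eq_self hle⟩)

/-- A homomorphism from a supplement `X` of `N` which is trivial on `X ⊓ N` extends to the whole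
group, trivially on `N`. -/
theorem exists_extension_of_sup_eq_top {M L : Type u} [Group M] [Group L] {X N : Subgroup M}
    [N.Normal] (h : X ⊔ N = ⊤) (f : X →* L) (hf : N.subgroupOf X ≤ f.ker) :
    ∃ f' : M →* L, (∀ x : X, f' x = f x) ∧ N ≤ f'.ker := by
  let π : X →* M ⧸ N := (QuotientGroup.mk' N).comp X.subtype
  have hπ : Function.Surjective π := by
    rintro ⟨m⟩
    have hm : m ∈ X ⊔ N := by rw [h]; trivial
    obtain ⟨x, hx, n, hn, rfl⟩ := Subgroup.mem_sup_of_normal_right.1 hm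
    refine ⟨⟨x, hx⟩, ?_⟩
    exact QuotientGroup.eq.2 (by simpa using hn)
  have hker : π.ker ≤ f.ker := by
    refine le_trans (fun x hx => ?_) hf
    exact (QuotientGroup.eq_one_iff (x : M)).1 hx
  refine ⟨(π.liftOfSurjective hπ ⟨f, hker⟩).comp (QuotientGroup.mk' N), fun x => ?_, fun n hn => ?_⟩
  · exact MonoidHom.liftOfRightInverse_comp_apply π _ (Function.rightInverse_surjInv hπ) ⟨f, hker⟩ x
  · rw [MonoidHom.mem_ker, MonoidHom.comp_apply, QuotientGroup.mk'_apply,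
      (QuotientGroup.eq_one_iff n).2 hn, map_one]

/-- Induction on `|M|`. If the given surjection does not kill `N`, the `B_K`-condition on `L` yields
a proper subgroup `X` that supplements both `ker f` and `N` and has `m_{X,X∩N} ≠ 0`. The map
obtained for `X` extends to `M = XN`. -/
theorem exists_overHom_of_mNumber_ne_zero {L M : Type u} [Group L] [Finite L] [Group M] [Finite M]
    {φ : L →* K} (hφ : IsBGroup φ) {ψ : M →* K} (h : OverQuotient ψ φ) (N : Subgroup M) [N.Normal]
    (hN : N ≤ ψ.ker) (hm : mNumber N ≠ 0) :
    ∃ f : M →* L, Function.Surjective f ∧ IsOverHom ψ φ f ∧ N ≤ f.ker := by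
  classical
  induction hn : Nat.card M using Nat.strong_induction_on generalizing M with
  | _ n ih =>
    obtain ⟨f, hf, hover⟩ := h
    by_cases hNf : N ≤ f.ker
    · exact ⟨f, hf, hover, hNf⟩
    let : Fintype (Subgroup M) := Fintype.ofFinite _
    have h0 : mNumber (N.map f) = 0 := by
      refine hφ _ (Subgroup.Normal.map inferInstance f hf) ?_ ?_
      · rintro _ ⟨x, hx, rfl⟩
        exact hover.map_ker.2 (hN hx)
      · rwa [Ne, Subgroup.map_eq_bot_iff]
    -- By `h0` the total over the supplements `X` of `ker f` is zero. The term `X = ⊤` is `|M|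
    -- m_{M,N} ≠ 0`, so a proper supplement also contributes.
    have hsum := sum_sup_ker_eq_top hf N
    rw [h0, mul_zero, ← Finset.add_sum_erase _ _ (Finset.mem_univ ⊤), top_sup_eq, if_pos rfl,
      ← card_mul_mNumber] at hsum
    have hne : (Nat.card M : ℚ) * mNumber N ≠ 0 :=
      mul_ne_zero (Nat.cast_ne_zero.2 Nat.card_pos.ne') hm
    obtain ⟨X, hX, hX0⟩ := Finset.exists_ne_zero_of_sum_ne_zero
      (fun h => hne (by rwa [h, add_zero] at hsum))
    have hXtop := Finset.ne_of_mem_erase hX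
    rw [ite_ne_right_iff] at hX0
    obtain ⟨hXQ, hX0⟩ := hX0
    have hXN : X ⊔ N = ⊤ := by
      obtain ⟨Z, -, hZ⟩ := Finset.exists_ne_zero_of_sum_ne_zero hX0
      have hZN := (ite_ne_right_iff.1 (right_ne_zero_of_mul hZ)).1
      have hZX : Z ≤ X := by
        by_contra hle
        exact left_ne_zero_of_mul hZ (by rw [subgroupMoebius_of_not_le hle, Int.cast_zero])
      exact top_le_iff.1 (hZN ▸ sup_le_sup_right hZX N)
    let : Fintype (Subgroup X) := Fintype.ofFinite _
    have hX1 : mNumber (N.subgroupOf X) ≠ 0 := by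
      intro h1
      apply hX0
      have h2 := card_mul_mNumber (N.subgroupOf X)
      rw [h1, mul_zero] at h2
      have h3 := sum_subgroupMoebius_range (R := ℚ) X.subtype_injective
        (fun Z : Subgroup M => if Z ⊔ N = ⊤ then (Nat.card Z : ℚ) else 0)
      rw [X.range_subtype] at h3
      refine h3.trans (Eq.trans (Finset.sum_congr rfl fun B _ => ?_) h2.symm)
      simp only [map_subtype_sup_eq_top_iff hXN, Subgroup.card_map_of_injective X.subtype_injective]
    have hXf : Function.Surjective (f.comp X.subtype) := by
      intro l
      obtain ⟨m, rfl⟩ := hf l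
      have hm : m ∈ X ⊔ f.ker := by rw [hXQ]; trivial
      obtain ⟨x, hx, q, hq, rfl⟩ := Subgroup.mem_sup_of_normal_right.1 hm
      exact ⟨⟨x, hx⟩, by simp [(MonoidHom.mem_ker).1 hq]⟩
    obtain ⟨k, hk⟩ := hover
    obtain ⟨f₁, hf₁, ⟨k₁, hk₁⟩, hNf₁⟩ := ih (Nat.card X) (by
        rw [← hn, ← Subgroup.card_top (G := M)]
        exact Set.ncard_lt_ncard (SetLike.coe_ssubset_coe.2 hXtop.lt_top) (Set.toFinite _))
      (ψ := ψ.comp X.subtype) ⟨f.comp X.subtype, hXf, k, fun x => hk x⟩ (N.subgroupOf X)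
      (fun x hx => hN hx) hX1 rfl
    obtain ⟨f', hf', hNf'⟩ := exists_extension_of_sup_eq_top hXN f₁ hNf₁
    refine ⟨f', fun l => ?_, ⟨k₁, fun m => ?_⟩, hNf'⟩
    · obtain ⟨x, rfl⟩ := hf₁ l
      exact ⟨x, hf' x⟩
    · have hm : m ∈ X ⊔ N := by rw [hXN]; trivial
      obtain ⟨x, hx, q, hq, rfl⟩ := Subgroup.mem_sup_of_normal_right.1 hm
      rw [map_mul ψ, map_mul f', (MonoidHom.mem_ker).1 (hN hq), (MonoidHom.mem_ker).1 (hNf' hq),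
        mul_one, mul_one]
      exact (hk₁ ⟨x, hx⟩).trans (congrArg φ (hf' ⟨x, hx⟩).symm)

end Over

/-! ### The ideal attached to a `B_K`-group -/

section Ideal

variable {F : Type v} [Field F] {K : Type u} [Group K]

theorem IsConjSubgroup.overIso {G : Type u} [Group G] {X Z : Subgroup (G × K)}
    (h : IsConjSubgroup X Z) : OverIso (p2 X) (p2 Z) := by
  obtain ⟨g, rfl⟩ := h
  refine OverIso.symm (OverIso.of_mulEquiv
    (Z.equivMapOfInjective (MulAut.conj g).toMonoidHom (MulAut.conj g).injective) ⟨g.2, ?_⟩)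
  intro z
  rfl

theorem overIso_graphSubgroup {L : Type u} [Group L] (φ : L →* K) :
    OverIso (p2 (graphSubgroup φ)) φ := by
  refine OverIso.symm (OverIso.of_mulEquiv (MonoidHom.ofInjective (f := (MonoidHom.id L).prod φ)
    fun a b h => (Prod.ext_iff.1 h).1) ⟨1, fun l => ?_⟩)
  rw [map_one]
  rfl

theorem overQuotient_map {G H : Type u} [Group G] [Group H] (f : G × K →* H × K)
    (hf : ∀ x, (f x).2 = x.2) (Z : Subgroup (G × K)) : OverQuotient (p2 Z) (p2 (Z.map f)) := by
  refine ⟨f.subgroupMap Z, f.subgroupMap_surjective Z, 1, fun z => ?_⟩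
  rw [map_one]
  exact (hf z).symm

/-! ### Marks of restrictions and products -/

theorem mark_resHom {G H : Type u} [Group G] [Group H] (f : H →* G) (Y : Subgroup H) (α : FB F G) :
    mark F Y (resHom F f α) = mark F (Y.map f) α := by
  have h : mark F Y ∘ₗ resHom F f = mark F (Y.map f) := by
    refine FB.hom_ext fun S => ?_
    rw [LinearMap.comp_apply, resHom, FB.lift_cls, mark_cls, mark_cls]
    refine congrArg Nat.cast (Nat.card_congr (Equiv.subtypeEquivRight fun s => ?_))
    constructor
    · rintro h _ ⟨y, hy, rfl⟩
      exact h y hy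
    · exact fun h y hy => h _ ⟨y, hy, rfl⟩
  exact LinearMap.congr_fun h α

theorem mark_extProd {G H : Type u} [Group G] [Group H] (Y : Subgroup (G × H)) (α : FB F G)
    (β : FB F H) : mark F Y (extProd F α β) =
      mark F (Y.map (MonoidHom.fst G H)) α * mark F (Y.map (MonoidHom.snd G H)) β := by
  have h : (extProd F).compr₂ (mark F Y) = (LinearMap.mul F F).compl₁₂
      (mark F (Y.map (MonoidHom.fst G H))) (mark F (Y.map (MonoidHom.snd G H))) := by
    refine FB.hom_ext fun S => FB.hom_ext fun T => ?_
    rw [LinearMap.compr₂_apply, LinearMap.compl₁₂_apply, extProd, FB.lift_cls, FB.lift_cls,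
      mark_cls, mark_cls, mark_cls, LinearMap.mul_apply', ← Nat.cast_mul, fixedCard, fixedCard,
      fixedCard, ← Nat.card_prod]
    refine congrArg Nat.cast (Nat.card_congr ((Equiv.subtypeEquivRight fun s => ?_).trans
      Equiv.subtypeProdEquivProd))
    constructor
    · intro h
      refine ⟨?_, ?_⟩
      · rintro _ ⟨y, hy, rfl⟩
        exact congrArg Prod.fst (h y hy)
      · rintro _ ⟨y, hy, rfl⟩
        exact congrArg Prod.snd (h y hy)
    · exact fun h y hy => Prod.ext (h.1 _ ⟨y, hy, rfl⟩) (h.2 _ ⟨y, hy, rfl⟩)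
  exact LinearMap.congr_fun₂ h α β

theorem mark_shiftProd {G H : Type u} [Group G] [Group H] (Z : Subgroup ((G × H) × K))
    (α : FB F (G × K)) (β : FB F (H × K)) :
    mark F Z (shiftProd F K α β) =
      mark F ((Z.map (diagEmb G H K)).map (MonoidHom.fst _ _)) α *
        mark F ((Z.map (diagEmb G H K)).map (MonoidHom.snd _ _)) β := by
  rw [shiftProd, mark_resHom, mark_extProd]

theorem IsBGroup.mNumber_eq {L : Type u} [Group L] [Finite L] {φ : L →* K} (hφ : IsBGroup φ)
    {N : Subgroup L} (hN : N.Normal) (hker : N ≤ φ.ker) : mNumber N = 0 ∨ N = ⊥ := by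
  by_cases h : N = ⊥
  · exact Or.inr h
  · exact Or.inl (hφ N hN hker h)

theorem comap_rightStab_normal {G H A : Type u} [Group G] [Group H] [Group A] (W : Biset H G)
    {ι : A →* G} {Z : Subgroup H} {w : W.carrier} (hT : ι.range ≤ W.transporter Z w) :
    ((W.rightStab w).comap ι).Normal := by
  refine ⟨fun s hs g => ?_⟩
  simpa using Biset.conj_mem_rightStab (hT ⟨g, rfl⟩) (Subgroup.mem_comap.1 hs)

variable [Finite K]

/-- From `Zw = wA`, sending `z` to the class of any `a` with `zw = wa` is a surjective homomorphism
from `Z` to `A` modulo the stabilizer of `w`. Since `f` kills that stabilizer, it can be composed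
with this map. -/
theorem overQuotient_of_covers {G H L A : Type u} [Group G] [Group H] [Group L] [Group A]
    {φ : L →* K} (U : Biset H G) {ι : A →* G × K} {Z : Subgroup (H × K)} {w : (U.shift K).carrier}
    (hT : ι.range ≤ (U.shift K).transporter Z w) (hC : (U.shift K).Covers Z w ι.range)
    {f : A →* L} (hf : Function.Surjective f)
    (hover : IsOverHom ((MonoidHom.snd G K).comp ι) φ f)
    (hN : ((U.shift K).rightStab w).comap ι ≤ f.ker) : OverQuotient (p2 Z) φ := by
  have key : ∀ a b : A, MulOpposite.op (ι a) • w = MulOpposite.op (ι b) • w → f a = f b := by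
    intro a b h
    have hs : a * b⁻¹ ∈ ((U.shift K).rightStab w).comap ι := by
      rw [Subgroup.mem_comap, Biset.mem_rightStab, map_mul, MulOpposite.op_mul, mul_smul, h,
        smul_smul, ← MulOpposite.op_mul]
      simp
    have := hN hs
    rw [MonoidHom.mem_ker, map_mul, map_inv, mul_inv_eq_one] at this
    exact this
  have hC' : ∀ z : Z, ∃ a : A, (z : H × K) • w = MulOpposite.op (ι a) • w := by
    intro z
    obtain ⟨_, ⟨a, rfl⟩, h⟩ := hC z z.2
    exact ⟨a, h⟩
  choose a ha using hC'
  let g : Z →* L := MonoidHom.mk' (fun z => f (a z)) (by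
    intro z z'
    rw [← map_mul]
    refine key _ _ ?_
    rw [← ha, map_mul, MulOpposite.op_mul, mul_smul, ← ha z,
      ← smul_comm (z : H × K), ← ha z', smul_smul, Subgroup.coe_mul])
  refine ⟨g, fun l => ?_, ?_⟩
  · obtain ⟨b, rfl⟩ := hf l
    obtain ⟨z, hz, h⟩ := hT ⟨b, rfl⟩
    exact ⟨⟨z, hz⟩, key _ _ ((ha ⟨z, hz⟩).symm.trans h)⟩
  · obtain ⟨c, hc⟩ := hover
    -- In the `K`-component, `zw = wa` says that `z` and `a` have images conjugate by `w.2`; then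
    -- `c` comes from `f`.
    refine ⟨c * w.2⁻¹, fun z => ?_⟩
    have h1 : (z : H × K).2 * w.2 = w.2 * (ι (a z)).2 := congrArg Prod.snd (ha z)
    have h2 : ∀ k k' x : K, k' * k = k * x → MulAut.conj (c * k⁻¹) k' = MulAut.conj c x := by
      intro k k' x h
      rw [eq_mul_inv_of_mul_eq h]
      simp [MulAut.conj_apply, mul_assoc]
    exact (h2 _ _ _ h1).trans (hc (a z))

/-- `G × G` as a `(G, G × G)`-biset, with `G` acting diagonally on the left. -/
def diagBiset (G : Type u) [Group G] [Finite G] : Biset G (G × G) :=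
  letI act : MulAction G (G × G) :=
    MulAction.compHom (G × G) ((MonoidHom.id G).prod (MonoidHom.id G))
  { carrier := G × G
    left := act
    comm := ⟨fun a b p => (mul_assoc ((a, a) : G × G) p b.unop).symm⟩ }

/-- The embedding `(g, k) ↦ (g, g, k)`. -/
def diagHom (G K : Type u) [Group G] [Group K] : G × K →* (G × G) × K where
  toFun a := ((a.1, a.1), a.2)
  map_one' := rfl
  map_mul' _ _ := rfl

theorem diagBiset_tensor_iso {G : Type u} [Group G] [Finite G] (S : FinGSet ((G × G) × K)) :
    (((diagBiset G).shift K).tensor S).Iso (S.res (diagHom G K)) := by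
  let e : ((diagBiset G).shift K).carrier → (G × G) × K := fun w => w
  refine ⟨⟨Quotient.lift (s := ((diagBiset G).shift K).tensorSetoid S)
      (fun p => (e p.1 • p.2 : S.carrier)) ?_,
      fun s => Quotient.mk (((diagBiset G).shift K).tensorSetoid S) ((1 : (G × G) × K), s),
      ?_, ?_⟩, ?_⟩
  · rintro ⟨w, s⟩ q ⟨g, rfl⟩
    change e w • s = (e w * g) • g⁻¹ • s
    rw [smul_smul, mul_inv_cancel_right]
  · rintro ⟨w, s⟩
    refine Quotient.sound ⟨e w, Prod.ext ?_ ?_⟩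
    · exact (one_mul (e w)).symm
    · change s = (e w)⁻¹ • e w • s
      rw [inv_smul_smul]
  · intro s
    exact one_smul ((G × G) × K) (α := S.carrier) s
  · rintro h ⟨w, s⟩
    exact mul_smul (α := (G × G) × K) (β := S.carrier) (diagHom G K h) (e w) s

/-- Multiplication in `𝔽B_K(G)` recovered from the products and the action of bisets. -/
theorem mark_diagBiset_shiftProd {G : Type u} [Group G] [Finite G] (Z : Subgroup (G × K))
    (α β : FB F (G × K)) :
    mark F Z (((diagBiset G).shift K).map F (shiftProd F K α β)) = mark F Z α * mark F Z β := by
  have h : ((diagBiset G).shift K).map F = resHom F (diagHom G K) :=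
    FB.hom_ext fun S => by
      rw [Biset.map, resHom, FB.lift_cls, FB.lift_cls]
      exact cls_iso (diagBiset_tensor_iso S)
  have h1 : ((Z.map (diagHom G K)).map (diagEmb G G K)).map (MonoidHom.fst _ _) = Z := by
    rw [Subgroup.map_map, Subgroup.map_map]
    exact Z.map_id
  have h2 : ((Z.map (diagHom G K)).map (diagEmb G G K)).map (MonoidHom.snd _ _) = Z := by
    rw [Subgroup.map_map, Subgroup.map_map]
    exact Z.map_id
  rw [h, mark_resHom, mark_shiftProd, h1, h2]

/-- `K` acts freely on the second factor of `U × K`. This is why only normal subgroups inside the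
kernel matter for `B_K`-groups. -/
theorem comap_rightStab_le_ker {G H A : Type u} [Group G] [Group H] [Group A] (U : Biset H G)
    (ι : A →* G × K) (w : (U.shift K).carrier) :
    ((U.shift K).rightStab w).comap ι ≤ ((MonoidHom.snd G K).comp ι).ker := by
  intro a ha
  have h : w.2 * (ι a).2 = w.2 := congrArg Prod.snd ha
  exact mul_eq_left.1 h

variable [CharZero F]

/-- The ideal of the elements supported on the groups over `K` which have the `B_K`-group `(L, φ)`
as a quotient. -/
def supportIdeal (F : Type v) [Field F] [CharZero F] {L : Type u} [Group L] [Finite L]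
    {φ : L →* K} (hφ : IsBGroup φ) : GreenIdeal F K where
  carrier G _ _ :=
    { carrier := {α | ∀ Z : Subgroup (G × K), ¬ OverQuotient (p2 Z) φ → mark F Z α = 0}
      add_mem' := fun {a b} ha hb Z hZ => by rw [map_add, ha Z hZ, hb Z hZ, add_zero]
      zero_mem' := fun Z _ => map_zero _
      smul_mem' := fun c a ha Z hZ => by rw [map_smul, ha Z hZ, smul_zero] }
  map_mem := by
    classical
    intro G H _ _ _ _ U α hα Z hZ
    by_contra hne
    -- A nonzero mark must come from an idempotent component `e_X` of `α`, then from a single point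
    -- `w` of the biset.
    obtain ⟨X, hX, hXZ⟩ := exists_idem_of_ne_zero (mark F Z ∘ₗ (U.shift K).map F) hne
    have hXφ : OverQuotient (p2 X) φ := by
      by_contra h
      exact hX (hα X h)
    let : Fintype (U.shift K).carrier := Fintype.ofFinite _
    have hmark := Biset.mark_map_idem (F := F) X.subtype_injective (U.shift K) Z
    rw [X.range_subtype] at hmark
    rw [LinearMap.comp_apply, hmark] at hXZ
    obtain ⟨w, -, hw⟩ := Finset.exists_ne_zero_of_sum_ne_zero (right_ne_zero_of_mul hXZ)
    rw [ite_ne_right_iff] at hw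
    obtain ⟨⟨hT, hC⟩, hm⟩ := hw
    rw [← X.range_subtype] at hT hC
    have hnorm := comap_rightStab_normal _ hT
    obtain ⟨f, hf, hover, hN⟩ := exists_overHom_of_mNumber_ne_zero hφ hXφ
      (((U.shift K).rightStab w).comap X.subtype)
      (comap_rightStab_le_ker U X.subtype w)
      (right_ne_zero_of_mul (Rat.cast_ne_zero.1 hm))
    exact hZ (overQuotient_of_covers U hT hC hf hover hN)
  prod_mem := by
    intro G H _ _ _ _ α β hβ Z hZ
    rw [mark_shiftProd, hβ, mul_zero]
    intro h
    -- The mark of `β` is taken at the image of `Z` in `H × K`, which is a quotient of `Z` over `K`.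
    refine hZ (OverQuotient.trans ?_ h)
    rw [Subgroup.map_map]
    exact overQuotient_map _ (fun x => rfl) Z

theorem idem_graphSubgroup_mem {L : Type u} [Group L] [Finite L]
    {φ : L →* K} (hφ : IsBGroup φ) :
    idem F (graphSubgroup φ) ∈ (supportIdeal F hφ).carrier L := by
  intro Z hZ
  rw [mark_idem, if_neg]
  intro h
  exact hZ (h.symm.overIso.overQuotient.trans (overIso_graphSubgroup φ).overQuotient)

/-- `(G × L) / V` as a `(G, L)`-biset. -/
def quotientBiset {G L : Type u} [Group G] [Finite G] [Group L] [Finite L] (V : Subgroup (G × L)) :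
    Biset G L :=
  letI actL : MulAction G ((G × L) ⧸ V) := MulAction.compHom _ (MonoidHom.inl G L)
  letI actR : MulAction Lᵐᵒᵖ ((G × L) ⧸ V) :=
    MulAction.compHom _ ((MonoidHom.inr G L).comp (MulEquiv.inv' L).symm.toMonoidHom)
  { carrier := (G × L) ⧸ V
    left := actL
    right := actR
    comm := ⟨by
      rintro g l ⟨x⟩
      change ((g, 1) : G × L) • ((1, l.unop⁻¹) : G × L) • (x : (G × L) ⧸ V) =
        ((1, l.unop⁻¹) : G × L) • ((g, 1) : G × L) • (x : (G × L) ⧸ V)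
      rw [smul_smul, smul_smul]
      simp⟩ }

/-- The biset is `(G × L)/V` with `V` the set of pairs `(p₁(z), f(z))`. Since `L` is a `B_K`-group,
each term of `mark_map_idem` is 0 or has trivial stabilizer and value 1, so nothing cancels. -/
theorem exists_mark_map_ne_zero {G L : Type u} [Group G] [Finite G] [Group L] [Finite L]
    {φ : L →* K} (hφ : IsBGroup φ) {Z : Subgroup (G × K)} (hZ : OverQuotient (p2 Z) φ) :
    ∃ U : Biset G L, mark F Z ((U.shift K).map F (idem F (graphSubgroup φ))) ≠ 0 := by
  classical
  obtain ⟨f, hf, c, hc⟩ := hZ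
  let j : Z →* G × L := ((MonoidHom.fst G K).comp Z.subtype).prod f
  let U := quotientBiset j.range
  refine ⟨U, ?_⟩
  let : Fintype (U.shift K).carrier := Fintype.ofFinite _
  have hι : Function.Injective ((MonoidHom.id L).prod φ) := fun a b h => (Prod.ext_iff.1 h).1
  rw [graphSubgroup, Biset.mark_map_idem hι]
  refine mul_ne_zero (inv_ne_zero (Nat.cast_ne_zero.2 Nat.card_pos.ne')) ?_
  -- The component `c⁻¹` absorbs the inner automorphism by which `f` commutes with the maps to `K`.
  let w : (U.shift K).carrier := (((1 : G × L) : (G × L) ⧸ j.range), c⁻¹)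
  have hzw : ∀ z : Z, (z : G × K) • w =
      MulOpposite.op ((MonoidHom.id L).prod φ (f z)) • w := by
    intro z
    refine Prod.ext ?_ ?_
    · change (((z : G × K).1 * 1, 1 * 1) : G × L) = ((((1 * 1, (f z)⁻¹ * 1) : G × L)) : (G × L) ⧸ j.range)
      rw [QuotientGroup.eq]
      refine ⟨z⁻¹, ?_⟩
      rw [map_inv]
      refine Prod.ext ?_ ?_
      · simp [j]
      · simp [j]
    · change (z : G × K).2 * c⁻¹ = c⁻¹ * φ (f z)
      rw [← hc z, MulAut.conj_apply, mul_assoc, inv_mul_cancel_left]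
      rfl
  have hT : ((MonoidHom.id L).prod φ).range ≤ (U.shift K).transporter Z w := by
    rintro _ ⟨l, rfl⟩
    obtain ⟨z, rfl⟩ := hf l
    exact ⟨z, z.2, hzw z⟩
  have hC : (U.shift K).Covers Z w ((MonoidHom.id L).prod φ).range :=
    fun z hz => ⟨_, ⟨f ⟨z, hz⟩, rfl⟩, hzw ⟨z, hz⟩⟩
  have hN : ((U.shift K).rightStab w).comap ((MonoidHom.id L).prod φ) = ⊥ := by
    rw [eq_bot_iff]
    intro l hl
    have h1 : φ l = 1 := comap_rightStab_le_ker U _ w hl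
    have h2 : (((1 * 1, l⁻¹ * 1) : G × L) : (G × L) ⧸ j.range) = ((1 : G × L) : (G × L) ⧸ j.range) :=
      congrArg Prod.fst hl
    rw [QuotientGroup.eq] at h2
    obtain ⟨z, hz⟩ := h2
    have h3 : (z : G × K).1 = 1 := by simpa [j] using congrArg Prod.fst hz
    have h4 : f z = l := by simpa [j] using congrArg Prod.snd hz
    have h5 := hc z
    rw [h4, h1, map_eq_one_iff _ (MulAut.conj c).injective] at h5
    have h6 : z = 1 := Subtype.ext (Prod.ext h3 h5)
    rw [Subgroup.mem_bot, ← h4, h6, map_one]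
  -- `F` carries no order, so positivity is argued in `ℚ` and transferred by characteristic zero.
  have hcast : ∀ x : (U.shift K).carrier, (if ((MonoidHom.id L).prod φ).range ≤
        (U.shift K).transporter Z x ∧ (U.shift K).Covers Z x ((MonoidHom.id L).prod φ).range then
      (((Nat.card (((U.shift K).rightStab x).comap ((MonoidHom.id L).prod φ)) : ℚ) *
        mNumber (((U.shift K).rightStab x).comap ((MonoidHom.id L).prod φ)) : ℚ) : F) else 0) =
      ((if ((MonoidHom.id L).prod φ).range ≤
        (U.shift K).transporter Z x ∧ (U.shift K).Covers Z x ((MonoidHom.id L).prod φ).range then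
      ((Nat.card (((U.shift K).rightStab x).comap ((MonoidHom.id L).prod φ)) : ℚ) *
        mNumber (((U.shift K).rightStab x).comap ((MonoidHom.id L).prod φ)) : ℚ) else 0 : ℚ) : F) := by
    intro x
    split_ifs <;> simp
  simp_rw [hcast]
  rw [← Rat.cast_sum, Rat.cast_ne_zero]
  refine (Finset.sum_pos' (fun x _ => ?_) ⟨w, Finset.mem_univ _, ?_⟩).ne'
  · split_ifs with h
    · rcases hφ.mNumber_eq (comap_rightStab_normal _ h.1) (comap_rightStab_le_ker U _ x) with h0 | h0
      · rw [h0, mul_zero]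
      · rw [h0, mNumber_bot]
        positivity
    · rfl
  · rw [if_pos ⟨hT, hC⟩, hN, mNumber_bot]
    simp

/-- In the algebra `𝔽B_K(G)` one has `e_Z β = c e_Z`, with `c` the mark of `β` at `Z`, and ideals
are closed under this multiplication. -/
theorem idem_mem_of_mark_ne_zero {G : Type u} [Group G] [Finite G] (J : GreenIdeal F K)
    {β : FB F (G × K)} (hβ : β ∈ J.carrier G) {Z : Subgroup (G × K)} (hZ : mark F Z β ≠ 0) :
    idem F Z ∈ J.carrier G := by
  have h : idem F Z = (mark F Z β)⁻¹ •
      ((diagBiset G).shift K).map F (shiftProd F K (idem F Z) β) := by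
    refine mark_ext fun Y => ?_
    rw [map_smul, mark_diagBiset_shiftProd, mark_idem]
    split_ifs with h
    · rw [one_mul, ← h.mark_eq, smul_eq_mul, inv_mul_cancel₀ hZ]
    · simp
  rw [h]
  exact Submodule.smul_mem _ _ (J.map_mem _ _ _ _ (J.prod_mem _ _ _ _ hβ))

theorem idem_mem_eIdeal {G L : Type u} [Group G] [Finite G] [Group L] [Finite L]
    {φ : L →* K} (hφ : IsBGroup φ) {Z : Subgroup (G × K)} (hZ : OverQuotient (p2 Z) φ) :
    idem F Z ∈ (eIdeal F φ).carrier G := by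
  obtain ⟨U, hU⟩ := exists_mark_map_ne_zero (F := F) hφ hZ
  refine idem_mem_of_mark_ne_zero _ ((eIdeal F φ).map_mem L G U _ ?_) hU
  exact (Submodule.mem_iInf _).2 fun I => I.2

/-- The generator lies in `supportIdeal`, hence so does the ideal it generates. Conversely, the
idempotent expansion of such an `α` involves only idempotents already known to lie in the ideal. -/
theorem mem_eIdeal_iff {G L : Type u} [Group G] [Finite G] [Group L] [Finite L]
    {φ : L →* K} (hφ : IsBGroup φ) {α : FB F (G × K)} :
    α ∈ (eIdeal F φ).carrier G ↔
      ∀ Z : Subgroup (G × K), ¬ OverQuotient (p2 Z) φ → mark F Z α = 0 := by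
  constructor
  · intro h
    exact (Submodule.mem_iInf _).1 h ⟨supportIdeal F hφ, idem_graphSubgroup_mem hφ⟩
  · intro h
    obtain ⟨R, hR⟩ := exists_isConjReps (G × K)
    have : Fintype R := Fintype.ofFinite R
    rw [eq_sum_mark_smul_idem hR α]
    refine sum_mem fun X _ => ?_
    by_cases hX : OverQuotient (p2 (X : Subgroup (G × K))) φ
    · exact Submodule.smul_mem _ _ (idem_mem_eIdeal hφ hX)
    · rw [h _ hX, zero_smul]
      exact zero_mem _

end Ideal

/-! ### Minimal groups -/

section Minimal

variable {F : Type v} [Field F] [CharZero F] {K : Type u} [Group K] [Finite K]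
  {L : Type u} [Group L] [Finite L] {φ : L →* K}

theorem exists_isMaxNormalAvoidingKer {L K : Type u} [Group L] [Finite L] [Group K] (φ : L →* K) :
    ∃ N : Subgroup L, IsMaxNormalAvoidingKer φ N := by
  obtain ⟨N, hN, hmax⟩ := Set.exists_max_image
    {N : Subgroup L | N.Normal ∧ N ⊓ φ.ker = ⊥} (fun N => Nat.card N) (Set.toFinite _)
    ⟨⊥, inferInstance, bot_inf_eq _⟩
  exact ⟨N, hN.1, hN.2, fun N' h h' => hmax N' ⟨h, h'⟩⟩

/-- `N` is the image under `f` of the kernel of the first projection `p` on `Z`. An element of `ker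
p` is determined by its `K`-component, so `f` is injective there and `N` avoids `ker φ`. The bounds
come from `|L| ≤ |Z| = |p(Z)||ker p| ≤ |G||N|`. -/
theorem exists_normal_of_overQuotient {L K : Type u} [Group L] [Finite L] [Group K] [Finite K]
    {φ : L →* K} {G : Type u} [Group G] [Finite G] {Z : Subgroup (G × K)}
    (hZ : OverQuotient (p2 Z) φ) :
    ∃ (N : Subgroup L) (_ : N.Normal), N ⊓ φ.ker = ⊥ ∧ Nat.card L ≤ Nat.card G * Nat.card N ∧
      (Nat.card G * Nat.card N ≤ Nat.card L → Nat.card Z = Nat.card L ∧ Nonempty (G ≃* L ⧸ N)) := by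
  obtain ⟨f, hf, hover⟩ := id hZ
  let p : Z →* G := (MonoidHom.fst G K).comp Z.subtype
  have hp : ∀ z ∈ p.ker, φ (f z) = 1 → z = 1 := fun z hz h =>
    Subtype.ext (Prod.ext hz (hover.map_ker.1 h))
  have hN : (p.ker.map f).Normal := Subgroup.Normal.map inferInstance f hf
  have hcardN : Nat.card (p.ker.map f) = Nat.card p.ker := by
    refine (Nat.card_congr (Equiv.ofBijective (f.subgroupMap p.ker)
      ⟨?_, f.subgroupMap_surjective p.ker⟩)).symm
    rw [injective_iff_map_eq_one]
    intro z hz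
    have hz' : f z = 1 := congrArg Subtype.val hz
    exact Subtype.ext (hp z z.2 (by rw [hz', map_one]))
  have hcardZ : Nat.card Z = Nat.card p.range * Nat.card p.ker := by
    rw [← Subgroup.card_mul_index p.ker, Subgroup.index_ker, mul_comm]
  have hrange : Nat.card p.range ≤ Nat.card G := Subgroup.card_le_card_group _
  have hLZ := hZ.card_le
  have hZG : Nat.card Z ≤ Nat.card G * Nat.card (p.ker.map f) := by
    rw [hcardN, hcardZ]
    exact Nat.mul_le_mul_right _ hrange
  refine ⟨p.ker.map f, hN, ?_, hLZ.trans hZG, fun h => ?_⟩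
  · rw [eq_bot_iff]
    rintro _ ⟨⟨z, hz, rfl⟩, hφ⟩
    rw [Subgroup.mem_bot, hp z hz hφ, map_one]
  · have hZL : Nat.card Z = Nat.card L := le_antisymm (hZG.trans h) hLZ
    refine ⟨hZL, ⟨?_⟩⟩
    have hbij : Function.Bijective f := (Nat.bijective_iff_surjective_and_card f).2 ⟨hf, hZL⟩
    -- Equality in the bounds forces `p(Z)` to have order `|G|`.
    have hp' : Function.Surjective p := by
      rw [← MonoidHom.range_eq_top]
      refine Subgroup.eq_top_of_card_eq _ (le_antisymm hrange ?_)
      rw [← hZL, hcardN, hcardZ] at h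
      exact Nat.le_of_mul_le_mul_right h Nat.card_pos
    exact (QuotientGroup.quotientKerEquivOfSurjective p hp').symm.trans
      (QuotientGroup.congr p.ker (p.ker.map f) (MulEquiv.ofBijective f hbij) rfl)

theorem exists_normal_of_card_le {L K : Type u} [Group L] [Finite L] [Group K] [Finite K]
    {φ : L →* K} {G : Type u} [Group G] [Finite G] {N₀ : Subgroup L}
    (hN₀ : IsMaxNormalAvoidingKer φ N₀) (hG : Nat.card G * Nat.card N₀ ≤ Nat.card L)
    {Z : Subgroup (G × K)} (hZ : OverQuotient (p2 Z) φ) :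
    OverIso (p2 Z) φ ∧ ∃ (N : Subgroup L) (_ : N.Normal),
      IsMaxNormalAvoidingKer φ N ∧ Nonempty (G ≃* L ⧸ N) := by
  obtain ⟨N, hN, hNφ, hle, h⟩ := exists_normal_of_overQuotient hZ
  have hNN₀ := hN₀.2.2 N hN hNφ
  obtain ⟨hcard, hiso⟩ := h ((Nat.mul_le_mul_left _ hNN₀).trans hG)
  have hN₀N : Nat.card N₀ ≤ Nat.card N :=
    Nat.le_of_mul_le_mul_left (hG.trans hle) Nat.card_pos
  exact ⟨OverIso.of_overQuotient hZ hcard, N, hN,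
    ⟨hN, hNφ, fun N' h h' => (hN₀.2.2 N' h h').trans hN₀N⟩, hiso⟩

/-- If `Z ↠ M ↠ L` with `Z ≅ L`, all three orders agree and `M ≅ L`. So no proper cover of `L` is a
quotient of a subgroup of `G × K`, and all marks vanish. -/
theorem eIdeal0_eq_bot {G : Type u} [Group G] [Finite G]
    (h : ∀ Z : Subgroup (G × K), OverQuotient (p2 Z) φ → OverIso (p2 Z) φ) :
    (eIdeal0 F φ).carrier G = ⊥ := by
  refine iSup_eq_bot.2 fun c => ?_
  rw [eq_bot_iff]
  intro α hα
  rw [Submodule.mem_bot]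
  refine mark_ext fun Z => ?_
  rw [map_zero]
  refine (mem_eIdeal_iff c.isBGroup).1 hα Z fun hZ => c.not_iso ?_
  refine OverIso.of_overQuotient c.quotient (le_antisymm ?_ c.quotient.card_le)
  rw [← (h Z (hZ.trans c.quotient)).card_eq]
  exact hZ.card_le

theorem ker_SProj_eq_bot {G : Type u} [Group G] [Finite G]
    (h : ∀ Z : Subgroup (G × K), OverQuotient (p2 Z) φ → OverIso (p2 Z) φ) :
    LinearMap.ker (SProj F φ G) = ⊥ := by
  rw [SProj, Submodule.ker_mkQ, eIdeal0_eq_bot h, Submodule.submoduleOf, Submodule.comap_bot,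
    Submodule.ker_subtype]

theorem exists_overQuotient_of_nontrivial (hφ : IsBGroup φ) {G : Type u} [Group G] [Finite G]
    (h : Nontrivial (SEval F φ G)) : ∃ Z : Subgroup (G × K), OverQuotient (p2 Z) φ := by
  by_contra! hne
  have : Subsingleton ((eIdeal F φ).carrier G) := by
    refine ⟨fun a b => Subtype.ext (mark_ext fun Z => ?_)⟩
    rw [(mem_eIdeal_iff hφ).1 a.2 Z (hne Z), (mem_eIdeal_iff hφ).1 b.2 Z (hne Z)]
  exact not_subsingleton (SEval F φ G)
    (Submodule.mkQ_surjective _).subsingleton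

theorem overIso_range_prod {L K : Type u} [Group L] [Group K] {φ : L →* K} {G : Type u} [Group G]
    {π : L →* G} (h : π.ker ⊓ φ.ker = ⊥) : OverIso (p2 (π.prod φ).range) φ := by
  have hinj : Function.Injective (π.prod φ) := by
    rw [← MonoidHom.ker_eq_bot_iff, MonoidHom.ker_prod, h]
  refine OverIso.symm (OverIso.of_mulEquiv (MonoidHom.ofInjective hinj) ⟨1, fun l => ?_⟩)
  rw [map_one]
  rfl

theorem idem_ne_zero {G : Type u} [Group G] [Finite G] (X : Subgroup G) : idem F X ≠ 0 := by
  intro h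
  have := mark_idem (F := F) X X
  rw [h, map_zero, if_pos (isConjSubgroup_refl X)] at this
  exact zero_ne_one this

/-- As `N ∩ ker φ = 1`, the map `l ↦ (lN, φ(l))` embeds `L` in `G × K` over `K`. The idempotent of
its image survives, because `e⁰` vanishes at `G` by the order count. -/
theorem nontrivial_SEval (hφ : IsBGroup φ) {N : Subgroup L} [N.Normal]
    (hN : IsMaxNormalAvoidingKer φ N) {G : Type u} [Group G] [Finite G] (e : G ≃* L ⧸ N) :
    Nontrivial (SEval F φ G) := by
  have hcard : Nat.card G * Nat.card N = Nat.card L := by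
    rw [Nat.card_congr e.toEquiv, ← Subgroup.card_eq_card_quotient_mul_card_subgroup]
  let π : L →* G := e.symm.toMonoidHom.comp (QuotientGroup.mk' N)
  have hπ : π.ker = N := by
    ext l
    simp [π]
  have hX : OverIso (p2 (π.prod φ).range) φ := overIso_range_prod (by rw [hπ, hN.2.1])
  have hmem : idem F (π.prod φ).range ∈ (eIdeal F φ).carrier G :=
    idem_mem_eIdeal hφ hX.overQuotient
  refine nontrivial_of_ne (SProj F φ G ⟨_, hmem⟩) 0 fun h => idem_ne_zero (F := F) (π.prod φ).range ?_
  have hinj := LinearMap.ker_eq_bot.1 (ker_SProj_eq_bot (F := F) (φ := φ) (G := G)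
    fun Z hZ => (exists_normal_of_card_le hN hcard.le hZ).1)
  exact congrArg Subtype.val (hinj (h.trans (map_zero _).symm))

theorem card_mul_le_of_isMinimalGroup (hφ : IsBGroup φ) {N : Subgroup L}
    (hN : IsMaxNormalAvoidingKer φ N) {G : Type u} [Group G] [Finite G]
    (hG : IsMinimalGroup (fun H => SEval F φ H) G) :
    Nat.card G * Nat.card N ≤ Nat.card L := by
  have := hN.1
  have h := hG.2 (L ⧸ N) (nontrivial_SEval hφ hN (MulEquiv.refl _))
  rw [Subgroup.card_eq_card_quotient_mul_card_subgroup N]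
  exact Nat.mul_le_mul_right _ h

theorem isMinimalGroup_iff (hφ : IsBGroup φ) (G : Type u) [Group G] [Finite G] :
    IsMinimalGroup (fun H => SEval F φ H) G ↔
      ∃ (N : Subgroup L) (_ : N.Normal), IsMaxNormalAvoidingKer φ N ∧ Nonempty (G ≃* L ⧸ N) := by
  constructor
  · intro hG
    obtain ⟨N, hN⟩ := exists_isMaxNormalAvoidingKer φ
    obtain ⟨Z, hZ⟩ := exists_overQuotient_of_nontrivial hφ hG.1
    exact (exists_normal_of_card_le hN (card_mul_le_of_isMinimalGroup hφ hN hG) hZ).2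
  · rintro ⟨N, hN', hN, ⟨e⟩⟩
    refine ⟨nontrivial_SEval hφ hN e, fun H _ _ hH => ?_⟩
    obtain ⟨Z, hZ⟩ := exists_overQuotient_of_nontrivial hφ hH
    obtain ⟨N', h1, h2, h3, -⟩ := exists_normal_of_overQuotient hZ
    -- `|G||N| = |L| ≤ |H||N'| ≤ |H||N|`, by maximality of `N`.
    have h4 := h3.trans (Nat.mul_le_mul_left _ (hN.2.2 N' h1 h2))
    rw [Subgroup.card_eq_card_quotient_mul_card_subgroup N, ← Nat.card_congr e.toEquiv] at h4
    exact Nat.le_of_mul_le_mul_right h4 Nat.card_pos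

theorem mark_sum_smul_idem {G : Type u} [Group G] [Finite G] {P : Subgroup G → Prop}
    {R : Set (Subgroup G)} [Fintype R] (hR : IsConjReps P R) (c : R → F) (Y : R) :
    mark F (Y : Subgroup G) (∑ X : R, c X • idem F (X : Subgroup G)) = c Y := by
  rw [map_sum, Finset.sum_eq_single Y _ (by simp)]
  · rw [map_smul, mark_idem, if_pos (isConjSubgroup_refl _), smul_eq_mul, mul_one]
  · intro X _ hXY
    rw [map_smul, mark_idem, if_neg, smul_zero]
    exact fun h => hXY (Subtype.ext (isConjReps_unique hR X.2 Y.2 h))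

/-- For a minimal `G`, every `Z ↠ L` is an isomorphic copy of `L`, so `e⁰(G) = 0` and the projection
is injective. Marks at the members of `R` are coordinates dual to the idempotents, giving both
independence and the expansion of any element. -/
theorem exists_basis_of_isMinimalGroup (hφ : IsBGroup φ) {G : Type u} [Group G] [Finite G]
    (hG : IsMinimalGroup (fun H => SEval F φ H) G) {R : Set (Subgroup (G × K))}
    (hR : IsConjReps (fun X => OverIso (p2 X) φ) R) :
    ∃ b : Module.Basis R F (SEval F φ G), ∀ X : R,
      ∃ h : idem F (X : Subgroup (G × K)) ∈ (eIdeal F φ).carrier G,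
        b X = SProj F φ G ⟨idem F (X : Subgroup (G × K)), h⟩ := by
  obtain ⟨N, hN⟩ := exists_isMaxNormalAvoidingKer φ
  have hiso : ∀ Z : Subgroup (G × K), OverQuotient (p2 Z) φ → OverIso (p2 Z) φ := fun Z hZ =>
    (exists_normal_of_card_le hN (card_mul_le_of_isMinimalGroup hφ hN hG) hZ).1
  have hmem : ∀ X : R, idem F (X : Subgroup (G × K)) ∈ (eIdeal F φ).carrier G := fun X =>
    idem_mem_eIdeal hφ (hR.1 X X.2).overQuotient
  have : Fintype R := Fintype.ofFinite R
  let v : R → (eIdeal F φ).carrier G := fun X => ⟨idem F (X : Subgroup (G × K)), hmem X⟩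
  have hli : LinearIndependent F v := by
    refine LinearIndependent.of_comp ((eIdeal F φ).carrier G).subtype ?_
    rw [Fintype.linearIndependent_iff]
    intro c hc Y
    rw [← mark_sum_smul_idem hR c Y]
    exact (congrArg _ hc).trans (map_zero _)
  have hspan : ∀ x : (eIdeal F φ).carrier G,
      x = ∑ X : R, mark F (X : Subgroup (G × K)) (x : FB F (G × K)) • v X := by
    intro x
    refine Subtype.ext (mark_ext fun Y => ?_)
    rw [AddSubmonoidClass.coe_finsetSum]
    change _ = mark F Y (∑ X : R, mark F (X : Subgroup (G × K)) (x : FB F (G × K)) •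
      idem F (X : Subgroup (G × K)))
    by_cases hY : OverQuotient (p2 Y) φ
    · obtain ⟨X, ⟨hX, hXY⟩, -⟩ := hR.2 Y (hiso Y hY)
      have hXY : IsConjSubgroup X Y := hXY
      rw [← hXY.mark_eq, ← hXY.mark_eq]
      exact (mark_sum_smul_idem hR (fun X => mark F (X : Subgroup (G × K)) (x : FB F (G × K)))
        ⟨X, hX⟩).symm
    · rw [(mem_eIdeal_iff hφ).1 x.2 Y hY, map_sum]
      refine (Finset.sum_eq_zero fun X _ => ?_).symm
      rw [map_smul, (mem_eIdeal_iff hφ).1 (hmem X) Y hY, smul_zero]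
  refine ⟨Module.Basis.mk (v := fun X => SProj F φ G (v X))
    (hli.map' (SProj F φ G) (ker_SProj_eq_bot hiso)) ?_,
    fun X => ⟨hmem X, by rw [Module.Basis.mk_apply]⟩⟩
  rintro y -
  obtain ⟨x, rfl⟩ := Submodule.mkQ_surjective _ y
  change SProj F φ G x ∈ _
  rw [hspan x, map_sum]
  refine sum_mem fun X _ => ?_
  rw [map_smul]
  exact Submodule.smul_mem _ _ (Submodule.subset_span ⟨X, rfl⟩)

end Minimal

end ShiftedBurnside

theorem mainTheorem5 {F : Type v} [Field F] [CharZero F]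
    {K : Type u} [Group K] [Finite K] {L : Type u} [Group L] [Finite L] (φ : L →* K)
    (hφ : ShiftedBurnside.IsBGroup φ) (G : Type u) [Group G] [Finite G] :
    (ShiftedBurnside.IsMinimalGroup (fun H => ShiftedBurnside.SEval F φ H) G ↔
      ∃ (N : Subgroup L) (_ : N.Normal),
        ShiftedBurnside.IsMaxNormalAvoidingKer φ N ∧ Nonempty (G ≃* L ⧸ N)) ∧
    (ShiftedBurnside.IsMinimalGroup (fun H => ShiftedBurnside.SEval F φ H) G →
      ∀ R : Set (Subgroup (G × K)),
        ShiftedBurnside.IsConjReps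
          (fun X => ShiftedBurnside.OverIso (ShiftedBurnside.p2 X) φ) R →
        ∃ b : Module.Basis R F (ShiftedBurnside.SEval F φ G),
          ∀ X : R, ∃ h : ShiftedBurnside.idem F (X : Subgroup (G × K)) ∈
              (ShiftedBurnside.eIdeal F φ).carrier G,
            b X = ShiftedBurnside.SProj F φ G ⟨ShiftedBurnside.idem F (X : Subgroup (G × K)), h⟩) :=
  ⟨ShiftedBurnside.isMinimalGroup_iff hφ G, fun hG _ hR =>
    ShiftedBurnside.exists_basis_of_isMinimalGroup hφ hG hR⟩
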